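/- Links are unoriented links in $S^3$ up to isotopy. A $\pm 5$-move on a link replaces two parallel strands by the same two strands twisted around each other by five half-twists of the same sense (right-handed or left-handed), and two links are *5-move equivalent* if they are related by a finite sequence of $\pm5$-moves, their inverses, and isotopies. A *rational tangle* is a 2-tangle obtained from the tangle $[0]$ or $[\infty]$ by repeatedly adding a single crossing, of either sign, on the right or at the bottom; a *rational link* is the numerator closure of a rational tangle. The Kauffman polynomial $\Lambda_L(a,x)$ of unoriented link diagrams is the regular isotopy invariant given by: $\Lambda_{\bigcirc}=1$; a curl of sign $\pm1$ contributes the factor $a^{\pm1}$; and $\Lambda_{L_+}+\Lambda_{L_-}=x(\Lambda_{L_0}+\Lambda_{L_\infty})$. Then $F_L(a,x)=a^{-w(L)}\Lambda_L(a,x)$, where $w$ is the writhe. For $a=1$ we have $F_L(1,x)=\Lambda_L(1,x)$, which is an invariant of unoriented links. Put $F_L=F_L\bigl(1,2\cos\tfrac{2\pi}{5}\bigr)$; that is, $F$ is a real-valued invariant of links satisfying these rules with $a=1$, $x=2\cos\frac{2\pi}{5}$, and such an invariant exists. **Theorem 2.9.** (i) Every rational link is 5-move equivalent to exactly one of the following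 four links: the trivial knot $T_1$, the trivial link of two components $T_2$, the Hopf link $H$, and the figure-eight knot $4_1$. (ii) Two rational links $L$ and $L'$ are 5-move equivalent if and only if $F_L=F_{L'}$. Moreover $F_{T_1}=1$, $F_{T_2}=\sqrt5$, $F_H=-1$ and $F_{4_1}=-\sqrt5$. -/

import Mathlib

/-!
Unoriented links in the 3-sphere, given by diagrams modulo Reidemeister moves.

A diagram in the plane is put in general position with respect to the height function and cut into
horizontal layers, read from the bottom to the top. A layer consists of vertical strands and one
elementary piece: a minimum (`cup`), a maximum (`cap`), or a crossing. Diagrams up to planar isotopy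
and Reidemeister moves are words in such layers modulo the moves listed below.
-/

namespace KnotDiagram

/-- The elementary pieces: `cup` is a local minimum, `cap` is a local maximum, `cross true` is the
crossing of two strands going up in which the strand from the bottom left to the top right is
the over-strand, and `cross false` is the one in which it is the under-strand. -/
inductive Piece
  | cup
  | cap
  | cross (s : Bool)

/-- The number of end points of a piece at its bottom. -/
def Piece.dom : Piece → ℕ
  | cup => 0
  | cap => 2
  | cross _ => 2

/-- The number of end points of a piece at its top. -/
def Piece.cod : Piece → ℕ
  | cup => 2
  | cap => 0
  | cross _ => 2

/-- A layer: a piece together with the number of vertical strands to the left of it. (The number of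
strands to the right of it is determined by the number of strands that enter the layer.) -/
structure Layer where
  left : ℕ
  piece : Piece

/-- The layer with a minimum to the right of `l` vertical strands. -/
abbrev cup (l : ℕ) : Layer := ⟨l, .cup⟩

/-- The layer with a maximum that joins the strands number `l` and `l + 1` (counted from `0`). -/
abbrev cap (l : ℕ) : Layer := ⟨l, .cap⟩

/-- The layer in which the strands number `l` and `l + 1` (counted from `0`) cross. -/
abbrev cross (s : Bool) (l : ℕ) : Layer := ⟨l, .cross s⟩

/-- A word in layers, the first letter being the bottom layer. -/
abbrev Word := List Layer

/-- The word `w` is a tangle diagram with `m` end points at the bottom and `n` at the top: every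
layer finds the strands that it needs. -/
def IsTangle : ℕ → Word → ℕ → Prop
  | m, [], n => m = n
  | m, t :: w, n => t.left + t.piece.dom ≤ m ∧ IsTangle (m - t.piece.dom + t.piece.cod) w n

/-- A link diagram is a tangle diagram without end points. -/
structure LinkDiagram where
  word : Word
  closed : IsTangle 0 word 0

/-- The local moves that generate regular isotopy. -/
inductive RegularMove : Word → Word → Prop
  /-- Two pieces beside each other are moved past each other vertically. -/
  | exchange (p q : Piece) (l k : ℕ) :
      RegularMove [⟨l, p⟩, ⟨l + p.cod + k, q⟩] [⟨l + p.dom + k, q⟩, ⟨l, p⟩]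
  /-- A minimum cancels with a neighbouring maximum. -/
  | zigzag_left (l : ℕ) : RegularMove [cup (l + 1), cap l] []
  | zigzag_right (l : ℕ) : RegularMove [cup l, cap (l + 1)] []
  /-- A strand that passes over (or under) one leg of a maximum or minimum is slid to the other. -/
  | slide_cap (s : Bool) (l : ℕ) :
      RegularMove [cross s l, cap (l + 1)] [cross (!s) (l + 1), cap l]
  | slide_cup (s : Bool) (l : ℕ) :
      RegularMove [cup (l + 1), cross s l] [cup l, cross (!s) (l + 1)]
  /-- The second Reidemeister move. -/
  | reidemeister_two (s : Bool) (l : ℕ) : RegularMove [cross s l, cross (!s) l] []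
  /-- The third Reidemeister move. -/
  | reidemeister_three (s : Bool) (l : ℕ) :
      RegularMove [cross s l, cross s (l + 1), cross s l]
        [cross s (l + 1), cross s l, cross s (l + 1)]

/-- The first Reidemeister move: `CurlMove e r r'` says that `r'` arises from `r` by the removal
of a curl whose crossing has sign `e` (for either orientation of the strand; since one of the two
strands of `cross true l` goes up and the other one down, its sign in a curl is `-1`). -/
inductive CurlMove : ℤ → Word → Word → Prop
  | cup_true (l : ℕ) : CurlMove (-1) [cup l, cross true l] [cup l]
  | cup_false (l : ℕ) : CurlMove 1 [cup l, cross false l] [cup l]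
  | cap_true (l : ℕ) : CurlMove (-1) [cross true l, cap l] [cap l]
  | cap_false (l : ℕ) : CurlMove 1 [cross false l, cap l] [cap l]

/-- Two link diagrams differ by the replacement of `r` by `r'` in one place. -/
def Replace (r r' : Word) (D D' : LinkDiagram) : Prop :=
  ∃ u v : Word, D.word = u ++ r ++ v ∧ D'.word = u ++ r' ++ v

/-- Two link diagrams differ by one regular move or by the removal of one curl. -/
def IsotopyStep (D D' : LinkDiagram) : Prop :=
  (∃ r r', RegularMove r r' ∧ Replace r r' D D') ∨
    ∃ e r r', CurlMove e r r' ∧ Replace r r' D D'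

/-- Unoriented (unframed) links up to isotopy: link diagrams modulo the equivalence relation
generated by the isotopy steps. -/
def Link : Type := Quot IsotopyStep

/-- The link with a given diagram. -/
def LinkDiagram.toLink (D : LinkDiagram) : Link := Quot.mk _ D

/-- One `5`-move or `(-5)`-move: two parallel strands are replaced by a twisted pair of strands with
five half-twists of the same sense. -/
def FiveMove (L L' : Link) : Prop :=
  ∃ (D D' : LinkDiagram) (s : Bool) (l : ℕ), D.toLink = L ∧ D'.toLink = L' ∧
    Replace [] [cross s l, cross s l, cross s l, cross s l, cross s l] D D'

/-- `5`-move equivalence of links: the equivalence relation generated by `±5`-moves. -/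
def FiveMoveEquiv : Link → Link → Prop := Relation.EqvGen FiveMove

/-- Diagrams of rational `2`-tangles in Conway's standard form. All these words have two end points
at the bottom and two at the top. One starts with the tangle `[0]` (a maximum below a minimum) or
with the tangle `[∞]` (two vertical strands) and repeatedly adds one crossing on the right, by which
the two right end points are twisted, or one crossing at the bottom, by which the two lower
end points are twisted. -/
inductive IsRationalTangle : Word → Prop
  | zero : IsRationalTangle [cap 0, cup 0]
  | infty : IsRationalTangle []
  | right {T : Word} (s : Bool) :
      IsRationalTangle T → IsRationalTangle ([cup 1] ++ T ++ [cross s 2, cap 1])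
  | bottom {T : Word} (s : Bool) : IsRationalTangle T → IsRationalTangle ([cross s 0] ++ T)

/-- The numerator closure of a `2`-tangle: the two upper end points are joined, and so are the two
lower ones. -/
def numerator (T : Word) : Word := [cup 0] ++ T ++ [cap 0]

/-- A rational link is the numerator of a rational tangle. -/
def IsRationalLink (L : Link) : Prop :=
  ∃ (T : Word) (D : LinkDiagram), IsRationalTangle T ∧ D.word = numerator T ∧ D.toLink = L

/-- The diagram of the trivial knot without crossings. -/
def circle : LinkDiagram := ⟨[cup 0, cap 0], by simp [IsTangle, Piece.dom, Piece.cod]⟩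

/-- The trivial knot. -/
def trivialKnot : Link := circle.toLink

/-- The trivial link of two components. -/
def trivialLinkTwo : Link :=
  LinkDiagram.toLink
    ⟨[cup 0, cap 0, cup 0, cap 0], by simp [IsTangle, Piece.dom, Piece.cod]⟩

/-- The Hopf link, as the closure of the 2-braid `σ₁²`. -/
def hopfLink : Link :=
  LinkDiagram.toLink
    ⟨[cup 0, cup 1, cross true 0, cross true 0, cap 1, cap 0],
      by simp [IsTangle, Piece.dom, Piece.cod]⟩

/-- The figure-eight knot, as the closure of the 3-braid `(σ₁ σ₂⁻¹)²`. -/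
def figureEightKnot : Link :=
  LinkDiagram.toLink
    ⟨[cup 0, cup 1, cup 2, cross true 0, cross false 1, cross true 0, cross false 1,
      cap 2, cap 1, cap 0], by simp [IsTangle, Piece.dom, Piece.cod]⟩

/-- The recursive rules of the Kauffman polynomial `Λ(a, x)` of link diagrams, with variables `a`
(invertible) and `x` in a commutative ring `R`: it is an invariant of regular isotopy, it is `1` on
the circle, a curl of sign `e` contributes the factor `a ^ e`, and
`Λ(L₊) + Λ(L₋) = x (Λ(L₀) + Λ(L_∞))`. The Kauffman polynomial of an oriented diagram is
`F = a ^ (-w) Λ` where `w` is the writhe; for `a = 1` it is `Λ`. -/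
structure IsKauffman {R : Type*} [CommRing R] (a : Rˣ) (x : R) (Λ : LinkDiagram → R) : Prop where
  regular : ∀ {r r' : Word} {D D' : LinkDiagram}, RegularMove r r' → Replace r r' D D' → Λ D = Λ D'
  circle : Λ circle = 1
  curl : ∀ {e : ℤ} {r r' : Word} {D D' : LinkDiagram}, CurlMove e r r' → Replace r r' D D' →
    Λ D = ((a ^ e : Rˣ) : R) * Λ D'
  skein : ∀ (u v : Word) (l : ℕ) (Dpos Dneg Dzero Dinfty : LinkDiagram),
    Dpos.word = u ++ [cross true l] ++ v → Dneg.word = u ++ [cross false l] ++ v →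
    Dzero.word = u ++ v → Dinfty.word = u ++ [cap l, cup l] ++ v →
    Λ Dpos + Λ Dneg = x * (Λ Dzero + Λ Dinfty)

/-- The values of a Kauffman polynomial at other parameters (such as the values of the two-variable
polynomial at complex or real numbers) satisfy the rules with these parameters. -/
theorem IsKauffman.map {R S : Type*} [CommRing R] [CommRing S] {a : Rˣ} {x : R}
    {Λ : LinkDiagram → R} (h : IsKauffman a x Λ) (f : R →+* S) :
    IsKauffman (Units.map (f : R →* S) a) (f x) (fun D => f (Λ D)) where
  regular hm hr := by rw [h.regular hm hr]
  circle := by rw [h.circle, map_one]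
  curl hm hr := by
    rw [h.curl hm hr, map_mul, ← map_zpow]
    rfl
  skein u v l Dp Dn Dz Di hp hn hz hi := by
    rw [← map_add, h.skein u v l Dp Dn Dz Di hp hn hz hi, map_mul, map_add]

/-- `F` assigns to every unoriented link `L` the value `F_L(1, x)` of the Kauffman polynomial. -/
def IsKauffmanValueAtOne (x : ℝ) (F : Link → ℝ) : Prop :=
  IsKauffman (1 : ℝˣ) x (fun D => F D.toLink)

end KnotDiagram

/-!
If `x ^ 2 + x = 1`, the skein relation along a row of half-twists forces `F` to take the same value
with five half-twists as with none, so `F` is an invariant of `5`-moves. Such an `F` exists at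
`x = 2 cos (2 π / 5)`, because there the skein relation holds for the Gaussian spin model over
`ZMod 5`; this is what separates the four basic links.

Conversely, bend the lower end points of a rational tangle up, so that it becomes a plat with four
end points. Adding a crossing now twists two neighbouring end points, and up to `5`-moves the two
twists satisfy the braid relation and have order five. Under these relations the orbit of the
trivial plats has at most twelve points, on which the twists act like rotations of an icosahedron by
a fifth of a turn about two neighbouring vertices. The closure of a plat does not see the outer
twist, and the four orbits of this rotation on the twelve vertices, of sizes 5, 1, 5 and 1, close up
to the four basic links.
-/

namespace KnotDiagram

open Finset

/-! ### Invariants from spin models -/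

/-- A symmetric spin model in the sense of Jones, with its modulus normalized to `1`: two mutually
inverse symmetric matrices of Boltzmann weights, one for each sense of a crossing, subject to the
second Reidemeister move and the star-triangle relation. The loop value is `D`. -/
structure SpinModel (X K : Type*) [Fintype X] [DecidableEq X] [Field K] where
  weight : Bool → X → X → K
  D : K
  D_ne_zero : D ≠ 0
  D_mul_self : D * D = Fintype.card X
  symm : ∀ s a b, weight s a b = weight s b a
  diag : ∀ s a, weight s a a = 1
  sum_weight : ∀ s a, ∑ b, weight s a b = D
  mul_not : ∀ s a b, weight s a b * weight (!s) a b = 1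
  sum_mul_not : ∀ s a b, ∑ t, weight s a t * weight (!s) t b = if a = b then D * D else 0
  star_triangle : ∀ s a b c, ∑ t, weight (!s) a t * weight s b t * weight (!s) t c =
    D * (weight s a b * weight (!s) a c * weight s b c)

/-- The regions met by a horizontal line, from left to right: the region number `i` has `i` strands
to its left. A shaded region carries a spin, an unshaded one carries `none`. -/
abbrev Row (X : Type*) := ℕ → Option X

namespace Row

variable {X : Type*}

/-- The rows in which the regions are alternately unshaded and shaded, the leftmost region being
unshaded. -/
def checkerboard (X : Type*) : Set (Row X) := {σ | ∀ i, (σ i).isSome ↔ Odd i}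

/-- The row above a layer with the piece `p` at position `l` and the row `σ` below it, where `t` is
the region between the two upper end points of `p`. It does not depend on `t` if `p` is a
maximum. -/
def splice (p : Piece) (l : ℕ) (t : Option X) (σ : Row X) : Row X := fun i =>
  if i ≤ l then σ i else if i < l + p.cod then t else σ (i - p.cod + p.dom)

theorem splice_of_le {p : Piece} {l i : ℕ} (t : Option X) (σ : Row X) (h : i ≤ l) :
    splice p l t σ i = σ i := if_pos h

theorem splice_comm {p q : Piece} {l k : ℕ} {t u : Option X} {σ : Row X}
    (h : p = .cap → σ l = σ (l + 2)) :
    splice q (l + p.cod + k) u (splice p l t σ) =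
      splice p l t (splice q (l + p.dom + k) u σ) := by
  funext i
  cases p <;> cases q <;> simp only [splice, Piece.dom, Piece.cod] at h ⊢ <;> grind

theorem splice_cross_splice_cross (s s' : Bool) {s'' : Bool} {l : ℕ} {t u : Option X} {σ : Row X} :
    splice (.cross s') l u (splice (.cross s'') l t σ) = splice (.cross s) l u σ := by
  funext i
  grind [splice, Piece.dom, Piece.cod]

theorem splice_cross_eq_self (s : Bool) {l : ℕ} {t : Option X} {σ : Row X} (h : σ (l + 1) = t) :
    splice (.cross s) l t σ = σ := by
  funext i
  grind [splice, Piece.dom, Piece.cod]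

theorem unshaded_or_shaded {σ : Row X} (h : σ ∈ checkerboard X) (l : ℕ) :
    (∃ b d, σ l = none ∧ σ (l + 1) = some b ∧ σ (l + 2) = none ∧ σ (l + 3) = some d) ∨
      ∃ a c, σ l = some a ∧ σ (l + 1) = none ∧ σ (l + 2) = some c ∧ σ (l + 3) = none := by
  have flip (i : ℕ) : (σ (i + 1)).isSome ↔ ¬(σ i).isSome := by rw [h, h, Nat.odd_add_one]
  have f0 := flip l
  have f1 := flip (l + 1)
  have f2 := flip (l + 2)
  rcases h0 : σ l <;> rcases h1 : σ (l + 1) <;> rcases h2 : σ (l + 2) <;>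
    rcases h3 : σ (l + 3) <;> simp_all

/-- The checkerboard row all of whose spins are `a`. -/
def uniform (a : X) : Row X := fun i => if Odd i then some a else none

theorem uniform_mem_checkerboard (a : X) : uniform a ∈ checkerboard X := by
  intro i
  by_cases h : Odd i <;> simp [uniform, h]

end Row

namespace SpinModel

open Row

variable {X K : Type*} [Fintype X] [DecidableEq X] [Field K] (M : SpinModel X K)

/-- The contribution of a piece to the state sum, in terms of the three regions that its bottom end
points separate and the region `t` between its top end points. A minimum has no bottom end points:
only the first region counts. A maximum has no top end points: `t` is pinned to `none`. -/
def faceWeight : Piece → Option X → Option X → Option X → Option X → K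
  | .cup, none, _, _, some _ => M.D⁻¹
  | .cup, some _, _, _, none => 1
  | .cap, none, some _, none, none => 1
  | .cap, some a, none, some c, none => if a = c then M.D else 0
  | .cross s, none, some b, none, some t => M.D⁻¹ * M.weight (!s) b t
  | .cross s, some a, none, some c, none => M.weight s a c
  | _, _, _, _, _ => 0

/-- The transfer operator of a layer, from functions of the row above it to functions of the row
below it. -/
def transfer (t : Layer) : (Row X → K) →ₗ[K] (Row X → K) where
  toFun f σ := ∑ u, M.faceWeight t.piece (σ t.left) (σ (t.left + 1)) (σ (t.left + 2)) u *
    f (splice t.piece t.left u σ)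
  map_add' f g := by
    funext σ
    simp only [Pi.add_apply, mul_add, sum_add_distrib]
  map_smul' c f := by
    funext σ
    simp only [Pi.smul_apply, smul_eq_mul, mul_left_comm _ c, ← mul_sum, RingHom.id_apply]

/-- The transfer operator of a word. -/
def wordTransfer (w : Word) : Module.End K (Row X → K) := (w.map M.transfer).prod

theorem wordTransfer_append (u v : Word) :
    M.wordTransfer (u ++ v) = M.wordTransfer u * M.wordTransfer v := by
  rw [wordTransfer, List.map_append, List.prod_append]
  rfl

section Evaluation

variable (f : Row X → K) {σ : Row X} {l : ℕ} {s : Bool} {a b c : X}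

theorem transfer_cup_unshaded (h : σ l = none) :
    M.transfer (cup l) f σ = M.D⁻¹ * ∑ t, f (splice .cup l (some t) σ) := by
  simp [transfer, Fintype.sum_option, faceWeight, h, mul_sum]

theorem transfer_cup_shaded (h : σ l = some a) :
    M.transfer (cup l) f σ = f (splice .cup l none σ) := by
  simp [transfer, Fintype.sum_option, faceWeight, h]

theorem transfer_cap_unshaded (h : σ l = none) (h' : σ (l + 1) = some b) (h'' : σ (l + 2) = none) :
    M.transfer (cap l) f σ = f (splice .cap l none σ) := by
  simp [transfer, Fintype.sum_option, faceWeight, h, h', h'']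

theorem transfer_cap_shaded (h : σ l = some a) (h' : σ (l + 1) = none) (h'' : σ (l + 2) = some c) :
    M.transfer (cap l) f σ = if a = c then M.D * f (splice .cap l none σ) else 0 := by
  simp [transfer, Fintype.sum_option, faceWeight, h, h', h'']

theorem transfer_cross_unshaded (h : σ l = none) (h' : σ (l + 1) = some b)
    (h'' : σ (l + 2) = none) :
    M.transfer (cross s l) f σ =
      M.D⁻¹ * ∑ t, M.weight (!s) b t * f (splice (.cross s) l (some t) σ) := by
  simp [transfer, Fintype.sum_option, faceWeight, h, h', h'', mul_sum, mul_assoc]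

theorem transfer_cross_shaded (h : σ l = some a) (h' : σ (l + 1) = none)
    (h'' : σ (l + 2) = some c) :
    M.transfer (cross s l) f σ = M.weight s a c * f σ := by
  simp [transfer, Fintype.sum_option, faceWeight, h, h', h'', splice_cross_eq_self s h']

end Evaluation

theorem faceWeight_congr (p : Piece) {a b c a' b' c' : Option X} (ha : a = a')
    (hbc : p ≠ .cup → b = b' ∧ c = c') (t : Option X) :
    M.faceWeight p a b c t = M.faceWeight p a' b' c' t := by
  subst ha
  cases p
  case cup => cases a <;> cases t <;> rfl
  all_goals
    obtain ⟨rfl, rfl⟩ := hbc nofun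
    rfl

theorem eq_of_faceWeight_cap_ne_zero {a b c t : Option X} (h : M.faceWeight .cap a b c t ≠ 0) :
    a = c := by
  rcases a with _ | a <;> rcases b with _ | b <;> rcases c with _ | c <;> rcases t with _ | t <;>
    simp_all [faceWeight]

theorem transfer_exchange (p q : Piece) (l k : ℕ) (f : Row X → K) :
    M.transfer ⟨l, p⟩ (M.transfer ⟨l + p.cod + k, q⟩ f) =
      M.transfer ⟨l + p.dom + k, q⟩ (M.transfer ⟨l, p⟩ f) := by
  funext σ
  simp only [transfer, LinearMap.coe_mk, AddHom.coe_mk, mul_sum]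
  rw [sum_comm]
  refine sum_congr rfl fun u _ => sum_congr rfl fun t _ => ?_
  have hp : M.faceWeight p (splice q (l + p.dom + k) u σ l)
        (splice q (l + p.dom + k) u σ (l + 1)) (splice q (l + p.dom + k) u σ (l + 2)) t =
      M.faceWeight p (σ l) (σ (l + 1)) (σ (l + 2)) t := by
    refine M.faceWeight_congr p (splice_of_le _ _ (by omega)) (fun h => ?_) t
    have hd : p.dom = 2 := by cases p <;> simp_all [Piece.dom]
    exact ⟨splice_of_le _ _ (by omega), splice_of_le _ _ (by omega)⟩
  rw [hp]
  by_cases h0 : M.faceWeight p (σ l) (σ (l + 1)) (σ (l + 2)) t = 0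
  · simp only [h0, zero_mul, mul_zero]
  have hcap : p = .cap → σ l = σ (l + 2) := by
    rintro rfl
    exact M.eq_of_faceWeight_cap_ne_zero h0
  have hrow (j : ℕ) : splice p l t σ (l + p.cod + k + j) = σ (l + p.dom + k + j) := by
    cases p <;> grind [splice, Piece.dom, Piece.cod]
  rw [show splice p l t σ (l + p.cod + k) = _ from hrow 0, hrow 1, hrow 2, splice_comm hcap,
    mul_left_comm]
  rfl

theorem splice_mem_checkerboard {p : Piece} {l : ℕ} {t : Option X} {σ : Row X}
    (hσ : σ ∈ checkerboard X) (h : M.faceWeight p (σ l) (σ (l + 1)) (σ (l + 2)) t ≠ 0) :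
    splice p l t σ ∈ checkerboard X := by
  have hl := hσ l
  have ht : p.cod = 2 → (t.isSome ↔ Odd (l + 1)) := by
    cases p <;> rcases hx : σ l with _ | x <;> rcases t with _ | t <;>
      simp_all [faceWeight, Piece.cod, Nat.odd_add_one]
  intro i
  have hi := hσ i
  have hi' := hσ (i - p.cod + p.dom)
  cases p <;> grind [splice, Piece.dom, Piece.cod]

theorem transfer_eqOn {f g : Row X → K} (h : Set.EqOn f g (checkerboard X)) (t : Layer) :
    Set.EqOn (M.transfer t f) (M.transfer t g) (checkerboard X) := by
  intro σ hσ
  refine sum_congr rfl fun u _ => ?_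
  by_cases h0 : M.faceWeight t.piece (σ t.left) (σ (t.left + 1)) (σ (t.left + 2)) u = 0
  · simp only [h0, zero_mul]
  · rw [h (M.splice_mem_checkerboard hσ h0)]

theorem wordTransfer_eqOn {f g : Row X → K} (h : Set.EqOn f g (checkerboard X)) (w : Word) :
    Set.EqOn (M.wordTransfer w f) (M.wordTransfer w g) (checkerboard X) := by
  induction w with
  | nil => exact h
  | cons t w ih => exact M.transfer_eqOn ih t

section Moves

attribute [local grind] splice Piece.dom Piece.cod

variable (f : Row X → K) (s : Bool) (l : ℕ)

theorem transfer_zigzag_left :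
    Set.EqOn (M.transfer (cup (l + 1)) (M.transfer (cap l) f)) f (checkerboard X) := by
  intro σ hσ
  have hrow (t : Option X) : splice .cap l none (splice .cup (l + 1) t σ) = σ := by
    funext i
    grind
  rcases unshaded_or_shaded hσ l with ⟨b, d, h0, h1, -, -⟩ | ⟨a, c, h0, h1, -, -⟩
  · rw [M.transfer_cup_shaded _ h1, M.transfer_cap_unshaded (b := b) _ (by grind) (by grind)
      (by grind), hrow]
  · have hcap (t : X) : M.transfer (cap l) f (splice .cup (l + 1) (some t) σ) =
        if a = t then M.D * f σ else 0 := by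
      rw [M.transfer_cap_shaded (a := a) (c := t) _ (by grind) (by grind) (by grind), hrow]
    rw [M.transfer_cup_unshaded _ h1]
    simp only [hcap, sum_ite_eq, mem_univ, if_true, inv_mul_cancel_left₀ M.D_ne_zero]

theorem transfer_zigzag_right :
    Set.EqOn (M.transfer (cup l) (M.transfer (cap (l + 1)) f)) f (checkerboard X) := by
  intro σ hσ
  have hrow (t : Option X) (ht : σ (l + 1) = t) :
      splice .cap (l + 1) none (splice .cup l t σ) = σ := by
    funext i
    grind
  rcases unshaded_or_shaded hσ l with ⟨b, d, h0, h1, -, -⟩ | ⟨a, c, h0, h1, -, -⟩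
  · have hcap (t : X) : M.transfer (cap (l + 1)) f (splice .cup l (some t) σ) =
        if t = b then M.D * f σ else 0 := by
      rw [M.transfer_cap_shaded (a := t) (c := b) _ (by grind) (by grind) (by grind)]
      grind
    rw [M.transfer_cup_unshaded _ h0]
    simp only [hcap, sum_ite_eq', mem_univ, if_true, inv_mul_cancel_left₀ M.D_ne_zero]
  · rw [M.transfer_cup_shaded _ h0, M.transfer_cap_unshaded (b := a) _ (by grind) (by grind)
      (by grind), hrow _ h1]

theorem transfer_slide_cap :
    Set.EqOn (M.transfer (cross s l) (M.transfer (cap (l + 1)) f))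
      (M.transfer (cross (!s) (l + 1)) (M.transfer (cap l) f)) (checkerboard X) := by
  intro σ hσ
  have hrow (t : Option X) (ht : σ (l + 3) = t) :
      splice .cap (l + 1) none (splice (.cross s) l t σ) = splice .cap l none σ := by
    funext i
    grind
  have hrow' (t : Option X) : splice .cap l none (splice (.cross !s) (l + 1) t σ) =
      splice .cap l none σ := by
    funext i
    grind
  rcases unshaded_or_shaded hσ l with ⟨b, d, h0, h1, h2, h3⟩ | ⟨a, c, h0, h1, h2, h3⟩
  · have hcap (t : X) : M.transfer (cap (l + 1)) f (splice (.cross s) l (some t) σ) =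
        if t = d then M.D * f (splice .cap l none σ) else 0 := by
      rw [M.transfer_cap_shaded (a := t) (c := d) _ (by grind) (by grind) (by grind)]
      grind
    rw [M.transfer_cross_unshaded _ h0 h1 h2, M.transfer_cross_shaded _ h1 h2 h3,
      M.transfer_cap_unshaded _ h0 h1 h2]
    simp only [hcap, mul_ite, mul_zero, sum_ite_eq', mem_univ, if_true]
    field_simp [M.D_ne_zero]
  · have hcap (t : X) : M.transfer (cap l) f (splice (.cross !s) (l + 1) (some t) σ) =
        if a = t then M.D * f (splice .cap l none σ) else 0 := by
      rw [M.transfer_cap_shaded (a := a) (c := t) _ (by grind) (by grind) (by grind), hrow']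
    rw [M.transfer_cross_shaded _ h0 h1 h2, M.transfer_cross_unshaded _ h1 h2 h3,
      M.transfer_cap_unshaded _ h1 h2 h3, M.symm s a c, Bool.not_not]
    simp only [hcap, mul_ite, mul_zero, sum_ite_eq, mem_univ, if_true]
    have hrow'' : splice .cap (l + 1) none σ = splice .cap l none σ := by
      funext i
      grind
    rw [hrow'']
    field_simp [M.D_ne_zero]

theorem transfer_slide_cup :
    Set.EqOn (M.transfer (cup (l + 1)) (M.transfer (cross s l) f))
      (M.transfer (cup l) (M.transfer (cross (!s) (l + 1)) f)) (checkerboard X) := by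
  intro σ hσ
  rcases unshaded_or_shaded hσ l with ⟨b, d, h0, h1, -, -⟩ | ⟨a, c, h0, h1, -, -⟩
  · have hrow (t : Option X) :
        splice (.cross s) l t (splice .cup (l + 1) none σ) = splice .cup l t σ := by
      funext i
      grind
    have hcross (t : X) : M.transfer (cross (!s) (l + 1)) f (splice .cup l (some t) σ) =
        M.weight (!s) t b * f (splice .cup l (some t) σ) :=
      M.transfer_cross_shaded _ (by grind) (by grind) (by grind)
    rw [M.transfer_cup_shaded _ h1, M.transfer_cup_unshaded _ h0,
      M.transfer_cross_unshaded (b := b) _ (by grind) (by grind) (by grind)]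
    simp only [hrow, hcross, M.symm (!s) b]
  · have hrow (t : Option X) :
        splice (.cross !s) (l + 1) t (splice .cup l none σ) = splice .cup (l + 1) t σ := by
      funext i
      grind
    have hcross (t : X) : M.transfer (cross s l) f (splice .cup (l + 1) (some t) σ) =
        M.weight s a t * f (splice .cup (l + 1) (some t) σ) :=
      M.transfer_cross_shaded _ (by grind) (by grind) (by grind)
    rw [M.transfer_cup_unshaded _ h1, M.transfer_cup_shaded _ h0,
      M.transfer_cross_unshaded (b := a) _ (by grind) (by grind) (by grind), Bool.not_not]
    simp only [hrow, hcross]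

theorem transfer_reidemeister_two :
    Set.EqOn (M.transfer (cross s l) (M.transfer (cross (!s) l) f)) f (checkerboard X) := by
  intro σ hσ
  rcases unshaded_or_shaded hσ l with ⟨b, d, h0, h1, h2, -⟩ | ⟨a, c, h0, h1, h2, -⟩
  · have hcross (t : X) : M.transfer (cross (!s) l) f (splice (.cross s) l (some t) σ) =
        M.D⁻¹ * ∑ u, M.weight s t u * f (splice (.cross s) l (some u) σ) := by
      rw [M.transfer_cross_unshaded (b := t) _ (by grind) (by grind) (by grind), Bool.not_not]
      simp only [splice_cross_splice_cross s]
    have hsum (u : X) :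
        ∑ t, M.weight (!s) b t * M.weight s t u = if b = u then M.D * M.D else 0 := by
      simpa only [Bool.not_not] using M.sum_mul_not (!s) b u
    rw [M.transfer_cross_unshaded _ h0 h1 h2]
    calc _ = M.D⁻¹ * M.D⁻¹ * ∑ u, (∑ t, M.weight (!s) b t * M.weight s t u) *
          f (splice (.cross s) l (some u) σ) := by
          simp only [hcross, mul_sum, sum_mul]
          rw [sum_comm]
          exact sum_congr rfl fun u _ => sum_congr rfl fun t _ => by ring
      _ = f (splice (.cross s) l (some b) σ) := by
          simp only [hsum, ite_mul, zero_mul, sum_ite_eq, mem_univ, if_true]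
          field_simp [M.D_ne_zero]
      _ = f σ := by rw [splice_cross_eq_self s h1]
  · rw [M.transfer_cross_shaded _ h0 h1 h2, M.transfer_cross_shaded _ h0 h1 h2, ← mul_assoc,
      M.mul_not, one_mul]

theorem sum_star_triangle (a b : X) (g : X → K) :
    M.D⁻¹ * ∑ t, M.weight (!s) a t * (M.weight s b t * (M.D⁻¹ * ∑ u, M.weight (!s) t u * g u)) =
      M.weight s a b * (M.D⁻¹ * ∑ u, M.weight (!s) a u * (M.weight s b u * g u)) := by
  calc _ = M.D⁻¹ * M.D⁻¹ * ∑ u,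
        (∑ t, M.weight (!s) a t * M.weight s b t * M.weight (!s) t u) * g u := by
        simp only [mul_sum, sum_mul]
        rw [sum_comm]
        exact sum_congr rfl fun u _ => sum_congr rfl fun t _ => by ring
    _ = _ := by
        simp only [M.star_triangle, mul_sum]
        refine sum_congr rfl fun u _ => ?_
        field_simp [M.D_ne_zero]

theorem transfer_reidemeister_three :
    Set.EqOn (M.transfer (cross s l) (M.transfer (cross s (l + 1)) (M.transfer (cross s l) f)))
      (M.transfer (cross s (l + 1)) (M.transfer (cross s l) (M.transfer (cross s (l + 1)) f)))
      (checkerboard X) := by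
  intro σ hσ
  rcases unshaded_or_shaded hσ l with ⟨b, d, h0, h1, h2, h3⟩ | ⟨a, c, h0, h1, h2, h3⟩
  · have hleft (t : X) : M.transfer (cross s (l + 1)) (M.transfer (cross s l) f)
        (splice (.cross s) l (some t) σ) =
          M.weight s d t * (M.D⁻¹ * ∑ u, M.weight (!s) t u *
            f (splice (.cross s) l (some u) σ)) := by
      rw [M.transfer_cross_shaded (a := t) (c := d) _ (by grind) (by grind) (by grind),
        M.transfer_cross_unshaded (b := t) _ (by grind) (by grind) (by grind), M.symm s d]
      simp only [splice_cross_splice_cross s]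
    have hright (t : X) : M.transfer (cross s (l + 1)) f (splice (.cross s) l (some t) σ) =
        M.weight s d t * f (splice (.cross s) l (some t) σ) := by
      rw [M.transfer_cross_shaded (a := t) (c := d) _ (by grind) (by grind) (by grind),
        M.symm s d]
    rw [M.transfer_cross_unshaded _ h0 h1 h2, M.transfer_cross_shaded _ h1 h2 h3,
      M.transfer_cross_unshaded _ h0 h1 h2]
    simp only [hleft, hright, M.sum_star_triangle]
  · have hleft (t : X) : M.transfer (cross s l) f (splice (.cross s) (l + 1) (some t) σ) =
        M.weight s a t * f (splice (.cross s) (l + 1) (some t) σ) :=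
      M.transfer_cross_shaded _ (by grind) (by grind) (by grind)
    have hright (t : X) : M.transfer (cross s l) (M.transfer (cross s (l + 1)) f)
        (splice (.cross s) (l + 1) (some t) σ) =
          M.weight s a t * (M.D⁻¹ * ∑ u, M.weight (!s) t u *
            f (splice (.cross s) (l + 1) (some u) σ)) := by
      rw [M.transfer_cross_shaded (a := a) (c := t) _ (by grind) (by grind) (by grind),
        M.transfer_cross_unshaded (b := t) _ (by grind) (by grind) (by grind)]
      simp only [splice_cross_splice_cross s]
    rw [M.transfer_cross_shaded _ h0 h1 h2, M.transfer_cross_unshaded _ h1 h2 h3,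
      M.transfer_cross_unshaded _ h1 h2 h3]
    simp only [hleft, hright, M.sum_star_triangle, M.symm s c]

theorem transfer_cup_cross :
    Set.EqOn (M.transfer (cup l) (M.transfer (cross s l) f)) (M.transfer (cup l) f)
      (checkerboard X) := by
  intro σ hσ
  rcases unshaded_or_shaded hσ l with ⟨b, d, h0, -, -, -⟩ | ⟨a, c, h0, -, -, -⟩
  · have hrow (t u : Option X) :
        splice (.cross s) l u (splice .cup l t σ) = splice .cup l u σ := by
      funext i
      grind
    have hcross (t : X) : M.transfer (cross s l) f (splice .cup l (some t) σ) =
        M.D⁻¹ * ∑ u, M.weight (!s) u t * f (splice .cup l (some u) σ) := by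
      rw [M.transfer_cross_unshaded (b := t) _ (by grind) (by grind) (by grind)]
      simp only [hrow, M.symm (!s) t]
    rw [M.transfer_cup_unshaded _ h0, M.transfer_cup_unshaded _ h0]
    simp only [hcross, ← mul_sum]
    rw [sum_comm]
    simp only [← sum_mul, M.sum_weight, ← mul_sum, inv_mul_cancel_left₀ M.D_ne_zero]
  · rw [M.transfer_cup_shaded _ h0, M.transfer_cup_shaded _ h0,
      M.transfer_cross_shaded (a := a) (c := a) _ (by grind) (by grind) (by grind), M.diag, one_mul]

theorem transfer_cross_cap :
    Set.EqOn (M.transfer (cross s l) (M.transfer (cap l) f)) (M.transfer (cap l) f)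
      (checkerboard X) := by
  intro σ hσ
  rcases unshaded_or_shaded hσ l with ⟨b, d, h0, h1, h2, -⟩ | ⟨a, c, h0, h1, h2, -⟩
  · have hrow (t : Option X) :
        splice .cap l none (splice (.cross s) l t σ) = splice .cap l none σ := by
      funext i
      grind
    have hcap (t : X) : M.transfer (cap l) f (splice (.cross s) l (some t) σ) =
        f (splice .cap l none σ) := by
      rw [M.transfer_cap_unshaded (b := t) _ (by grind) (by grind) (by grind), hrow]
    rw [M.transfer_cross_unshaded _ h0 h1 h2, M.transfer_cap_unshaded _ h0 h1 h2]
    simp only [hcap, ← sum_mul, M.sum_weight, inv_mul_cancel_left₀ M.D_ne_zero]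
  · rw [M.transfer_cross_shaded _ h0 h1 h2, M.transfer_cap_shaded _ h0 h1 h2]
    split_ifs with h
    · rw [h, M.diag, one_mul]
    · rw [mul_zero]

theorem transfer_skein {x : K} (hx : ∀ a b,
    M.weight true a b + M.weight false a b = x * (1 + if a = b then M.D else 0)) :
    Set.EqOn (M.transfer (cross true l) f + M.transfer (cross false l) f)
      (x • (f + M.transfer (cap l) (M.transfer (cup l) f))) (checkerboard X) := by
  intro σ hσ
  simp only [Pi.add_apply, Pi.smul_apply, smul_eq_mul]
  rcases unshaded_or_shaded hσ l with ⟨b, d, h0, h1, h2, -⟩ | ⟨a, c, h0, h1, h2, -⟩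
  · have hrow (t : Option X) : splice .cup l t (splice .cap l none σ) =
        splice (.cross true) l t σ := by
      funext i
      grind
    rw [M.transfer_cross_unshaded _ h0 h1 h2, M.transfer_cross_unshaded _ h0 h1 h2,
      M.transfer_cap_unshaded _ h0 h1 h2, M.transfer_cup_unshaded _ (by grind)]
    have hsign (t : Option X) : splice (.cross false) l t σ = splice (.cross true) l t σ := rfl
    calc _ = M.D⁻¹ * ∑ t, (M.weight true b t + M.weight false b t) *
          f (splice (.cross true) l (some t) σ) := by
          simp only [hsign, Bool.not_true, Bool.not_false, ← mul_add, ← sum_add_distrib, ← add_mul,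
            add_comm]
      _ = x * (f (splice (.cross true) l (some b) σ) +
          M.D⁻¹ * ∑ t, f (splice (.cross true) l (some t) σ)) := by
          simp only [hx, mul_assoc, ← mul_sum, add_mul, sum_add_distrib, one_mul, ite_mul, zero_mul,
            sum_ite_eq, mem_univ, if_true]
          field_simp [M.D_ne_zero]
          ring
      _ = _ := by simp only [splice_cross_eq_self true h1, hrow]
  · have hrow (h : a = c) : splice .cup l none (splice .cap l none σ) = σ := by
      funext i
      grind
    rw [M.transfer_cross_shaded _ h0 h1 h2, M.transfer_cross_shaded _ h0 h1 h2,
      M.transfer_cap_shaded _ h0 h1 h2, M.transfer_cup_shaded (a := a) _ (by grind), ← add_mul, hx]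
    split_ifs with h
    · rw [hrow h]
      ring
    · ring

end Moves

theorem wordTransfer_regularMove {r r' : Word} (h : RegularMove r r') (f : Row X → K) :
    Set.EqOn (M.wordTransfer r f) (M.wordTransfer r' f) (checkerboard X) := by
  cases h with
  | exchange p q l k => exact fun _ _ => congrFun (M.transfer_exchange p q l k f) _
  | zigzag_left l => exact M.transfer_zigzag_left f l
  | zigzag_right l => exact M.transfer_zigzag_right f l
  | slide_cap s l => exact M.transfer_slide_cap f s l
  | slide_cup s l => exact M.transfer_slide_cup f s l
  | reidemeister_two s l => exact M.transfer_reidemeister_two f s l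
  | reidemeister_three s l => exact M.transfer_reidemeister_three f s l

theorem wordTransfer_curlMove {e : ℤ} {r r' : Word} (h : CurlMove e r r') (f : Row X → K) :
    Set.EqOn (M.wordTransfer r f) (M.wordTransfer r' f) (checkerboard X) := by
  cases h with
  | cup_true l => exact M.transfer_cup_cross f true l
  | cup_false l => exact M.transfer_cup_cross f false l
  | cap_true l => exact M.transfer_cross_cap f true l
  | cap_false l => exact M.transfer_cross_cap f false l

/-- The partition function of a link diagram, normalized to be `1` on the circle. It is read off
at a row that meets no strand; the spin `a` fills the positions to the right of the diagram, which
do not contribute. -/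
def partitionFunction (a : X) (L : LinkDiagram) : K :=
  M.D⁻¹ * M.wordTransfer L.word 1 (uniform a)

theorem partitionFunction_replace (a : X) {r r' : Word}
    (h : ∀ f, Set.EqOn (M.wordTransfer r f) (M.wordTransfer r' f) (checkerboard X))
    {L L' : LinkDiagram} (hL : Replace r r' L L') :
    M.partitionFunction a L = M.partitionFunction a L' := by
  obtain ⟨u, v, hu, hv⟩ := hL
  simp only [partitionFunction, hu, hv, wordTransfer_append, Module.End.mul_apply]
  rw [M.wordTransfer_eqOn (h _) u (uniform_mem_checkerboard a)]

theorem isKauffman_partitionFunction (a : X) {x : K} (hx : ∀ a b,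
    M.weight true a b + M.weight false a b = x * (1 + if a = b then M.D else 0)) :
    IsKauffman 1 x (M.partitionFunction a) where
  regular h hL := M.partitionFunction_replace a (M.wordTransfer_regularMove h) hL
  circle := by
    change M.D⁻¹ * M.transfer (cup 0) (M.transfer (cap 0) 1) (uniform a) = 1
    have hcap (t : X) : M.transfer (cap 0) 1 (splice .cup 0 (some t) (uniform a)) = 1 :=
      M.transfer_cap_unshaded (b := t) _ (by simp [splice, uniform])
        (by simp [splice, Piece.cod]) (by simp [splice, uniform, Piece.dom, Piece.cod])
    rw [M.transfer_cup_unshaded _ (by simp [uniform])]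
    simp only [hcap, sum_const, card_univ, nsmul_eq_mul, mul_one, ← M.D_mul_self]
    field_simp [M.D_ne_zero]
  curl h hL := by
    rw [one_zpow, Units.val_one, one_mul]
    exact M.partitionFunction_replace a (M.wordTransfer_curlMove h) hL
  skein u v l Lp Ln Lz Li hp hn hz hi := by
    have h := M.wordTransfer_eqOn (M.transfer_skein (M.wordTransfer v 1) l hx) u
      (uniform_mem_checkerboard a)
    rw [map_add, map_smul, map_add] at h
    simp only [partitionFunction, hp, hn, hz, hi, wordTransfer_append, Module.End.mul_apply,
      ← mul_add, mul_left_comm x]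
    exact congrArg (M.D⁻¹ * ·) h

end SpinModel

theorem IsKauffman.eq_of_isotopyStep {R : Type*} [CommRing R] {x : R} {Λ : LinkDiagram → R}
    (h : IsKauffman 1 x Λ) {L L' : LinkDiagram} (hL : IsotopyStep L L') : Λ L = Λ L' := by
  rcases hL with ⟨r, r', hr, hL⟩ | ⟨e, r, r', hr, hL⟩
  · exact h.regular hr hL
  · rw [h.curl hr hL, one_zpow, Units.val_one, one_mul]

theorem isKauffman_re {x : ℝ} {Λ : LinkDiagram → ℂ} (h : IsKauffman 1 (x : ℂ) Λ) :
    IsKauffman 1 x fun L => (Λ L).re where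
  regular hr hL := by rw [h.regular hr hL]
  circle := by rw [h.circle, Complex.one_re]
  curl hr hL := by simp only [h.curl hr hL, one_zpow, Units.val_one, one_mul]
  skein u v l Lp Ln Lz Li hp hn hz hi := by
    rw [← Complex.add_re, h.skein u v l Lp Ln Lz Li hp hn hz hi, Complex.re_ofReal_mul,
      Complex.add_re]

/-! ### The Gaussian spin model -/

theorem two_mul_cos_two_pi_div_five : 2 * Real.cos (2 * Real.pi / 5) = (√5 - 1) / 2 := by
  rw [show 2 * Real.pi / 5 = 2 * (Real.pi / 5) by ring, Real.cos_two_mul, Real.cos_pi_div_five]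
  linear_combination Real.sq_sqrt (show (0 : ℝ) ≤ 5 by norm_num) / 4

/-- The Gaussian Boltzmann weights as functions of the difference of the spins: `ω ^ (± t ^ 2)`
for a primitive fifth root of unity `ω`. -/
noncomputable def gaussWeight (s : Bool) (t : ZMod 5) : ℂ :=
  ZMod.stdAddChar (if s then t ^ 2 else -t ^ 2)

theorem sqrt_five_mul_self : (√5 : ℂ) * √5 = 5 := by
  rw [← Complex.ofReal_mul, Real.mul_self_sqrt (by norm_num)]
  norm_num

theorem sqrt_five_ne_zero : (√5 : ℂ) ≠ 0 := by
  simp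

theorem stdAddChar_one_add_neg_one :
    (ZMod.stdAddChar (1 : ZMod 5) + ZMod.stdAddChar (-1 : ZMod 5) : ℂ) = (√5 - 1) / 2 := by
  have h1 := ZMod.stdAddChar_coe (N := 5) 1
  have h2 := ZMod.stdAddChar_coe (N := 5) (-1)
  have hcos := congrArg Complex.ofReal two_mul_cos_two_pi_div_five
  push_cast at h1 h2 hcos
  rw [h1, h2, ← hcos, Complex.two_cos]
  congr 2 <;> ring

theorem gaussWeight_true_add_false (t : ZMod 5) :
    gaussWeight true t + gaussWeight false t =
      ((√5 : ℂ) - 1) / 2 * (1 + if t = 0 then (√5 : ℂ) else 0) := by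
  have hsq : ∀ t : ZMod 5, t = 0 ∨ t ≠ 0 ∧ (t ^ 2 = 1 ∨ t ^ 2 = -1) := by decide
  rcases hsq t with rfl | ⟨h0, h | h⟩
  · simp only [gaussWeight, if_true, Bool.false_eq_true, if_false, zero_pow two_ne_zero, neg_zero,
      AddChar.map_zero_eq_one]
    linear_combination -sqrt_five_mul_self / 2
  all_goals
    rw [if_neg h0, ← stdAddChar_one_add_neg_one]
    simp [gaussWeight, h, add_comm]

theorem sum_gaussWeight (s : Bool) : ∑ t, gaussWeight s t = √5 := by
  have hsum : ∑ t, gaussWeight s t = 1 + 2 * (ZMod.stdAddChar (1 : ZMod 5) +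
      ZMod.stdAddChar (-1 : ZMod 5)) := by
    have hsq : (0 : ZMod 5) ^ 2 = 0 ∧ (1 : ZMod 5) ^ 2 = 1 ∧ (2 : ZMod 5) ^ 2 = -1 ∧
      (3 : ZMod 5) ^ 2 = -1 ∧ (4 : ZMod 5) ^ 2 = 1 := by decide
    obtain ⟨h0, h1, h2, h3, h4⟩ := hsq
    rw [show (univ : Finset (ZMod 5)) = {0, 1, 2, 3, 4} by decide, sum_insert (by decide),
      sum_insert (by decide), sum_insert (by decide), sum_insert (by decide), sum_singleton]
    cases s <;> simp only [gaussWeight, h0, h1, h2, h3, h4, if_true, Bool.false_eq_true, if_false,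
      neg_zero, neg_neg, AddChar.map_zero_eq_one] <;> ring
  rw [hsum, stdAddChar_one_add_neg_one]
  ring

theorem sum_gaussWeight_mul_not (s : Bool) (a b : ZMod 5) :
    ∑ t, gaussWeight s (a - t) * gaussWeight (!s) (t - b) = if a = b then (√5 : ℂ) * √5 else 0 := by
  set e : ZMod 5 := if s then 1 else -1 with he
  have hterm (t : ZMod 5) : gaussWeight s (a - t) * gaussWeight (!s) (t - b) =
      ZMod.stdAddChar (e * (a ^ 2 - b ^ 2)) * ZMod.stdAddChar (t * (2 * e * (b - a))) := by
    simp only [gaussWeight, ← AddChar.map_add_eq_mul, he]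
    congr 1
    cases s <;> simp <;> ring
  have hzero : 2 * e * (b - a) = 0 ↔ a = b := by
    clear hterm
    revert a b
    cases s <;> simp only [he] <;> decide
  simp only [hterm, ← mul_sum, AddChar.sum_mulShift _ (ZMod.isPrimitive_stdAddChar 5), hzero]
  split_ifs with h
  · simp [h, sqrt_five_mul_self]
  · simp

theorem gaussWeight_star_triangle (s : Bool) (a b c : ZMod 5) :
    ∑ t, gaussWeight (!s) (a - t) * gaussWeight s (b - t) * gaussWeight (!s) (t - c) =
      √5 * (gaussWeight s (a - b) * gaussWeight (!s) (a - c) * gaussWeight s (b - c)) := by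
  have hterm (t : ZMod 5) :
      gaussWeight (!s) (a - t) * gaussWeight s (b - t) * gaussWeight (!s) (t - c) =
        gaussWeight s (a - b) * gaussWeight (!s) (a - c) * gaussWeight s (b - c) *
          gaussWeight (!s) (t - (a - b + c)) := by
    simp only [gaussWeight, ← AddChar.map_add_eq_mul]
    congr 1
    cases s <;> simp <;> ring
  have hsum : ∑ t, gaussWeight (!s) (t - (a - b + c)) = √5 := by
    rw [← sum_gaussWeight (!s)]
    exact (Equiv.subRight _).sum_comp _
  rw [sum_congr rfl fun t _ => hterm t, ← mul_sum, hsum, mul_comm]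

/-- The spin model over `ZMod 5` with the Gaussian Boltzmann weights. -/
noncomputable def gaussModel : SpinModel (ZMod 5) ℂ where
  weight s a b := gaussWeight s (a - b)
  D := √5
  D_ne_zero := sqrt_five_ne_zero
  D_mul_self := by simp [sqrt_five_mul_self, ZMod.card]
  symm s a b := by rw [gaussWeight, gaussWeight, ← neg_sub, neg_sq]
  diag s a := by simp [gaussWeight]
  sum_weight s a := by
    rw [← sum_gaussWeight s]
    exact (Equiv.subLeft a).sum_comp _
  mul_not s a b := by
    rw [gaussWeight, gaussWeight, ← AddChar.map_add_eq_mul]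
    cases s <;> simp
  sum_mul_not := sum_gaussWeight_mul_not
  star_triangle := gaussWeight_star_triangle

theorem exists_isKauffmanValueAtOne :
    ∃ F : Link → ℝ, IsKauffmanValueAtOne (2 * Real.cos (2 * Real.pi / 5)) F := by
  have hmodel : IsKauffman 1 (((√5 - 1) / 2 : ℝ) : ℂ) (gaussModel.partitionFunction 0) := by
    refine gaussModel.isKauffman_partitionFunction 0 fun a b => ?_
    push_cast
    simpa only [gaussModel, sub_eq_zero] using gaussWeight_true_add_false (a - b)
  have h := isKauffman_re hmodel
  rw [← two_mul_cos_two_pi_div_five] at h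
  exact ⟨Quot.lift _ fun _ _ => h.eq_of_isotopyStep, h⟩

/-! ### Tangle diagrams up to isotopy and `5`-moves -/

section Tangles

attribute [local simp] IsTangle Piece.dom Piece.cod

theorem isTangle_append {m n : ℕ} {u v : Word} :
    IsTangle m (u ++ v) n ↔ ∃ k, IsTangle m u k ∧ IsTangle k v n := by
  induction u generalizing m with
  | nil => simp
  | cons t u ih => simp only [List.cons_append, IsTangle, ih, and_assoc, exists_and_left]

theorem isTangle_cross (s : Bool) {l m : ℕ} (hl : l + 2 ≤ m) : IsTangle m [cross s l] m :=
  ⟨hl, Nat.sub_add_cancel (le_of_add_le_right hl)⟩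

namespace IsTangle

variable {m n k : ℕ} {u v w : Word}

theorem append (hu : IsTangle m u k) (hv : IsTangle k v n) : IsTangle m (u ++ v) n :=
  isTangle_append.2 ⟨k, hu, hv⟩

theorem top_unique (h : IsTangle m w n) (h' : IsTangle m w k) : n = k := by
  induction w generalizing m with
  | nil => exact h.symm.trans h'
  | cons t w ih => exact ih h.2 h'.2

theorem add_right (h : IsTangle m w n) (k : ℕ) : IsTangle (m + k) w (n + k) := by
  induction w generalizing m with
  | nil => exact congrArg (· + k) h
  | cons t w ih =>
    obtain ⟨ht, hw⟩ := h
    refine ⟨by omega, ?_⟩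
    rw [show m + k - t.piece.dom + t.piece.cod = m - t.piece.dom + t.piece.cod + k by omega]
    exact ih hw

end IsTangle

/-- The local moves that generate isotopy and `5`-move equivalence. -/
inductive Move : Word → Word → Prop
  | regular {r r' : Word} : RegularMove r r' → Move r r'
  | curl {e : ℤ} {r r' : Word} : CurlMove e r r' → Move r r'
  | five (s : Bool) (l : ℕ) :
      Move [] [cross s l, cross s l, cross s l, cross s l, cross s l]

/-- Two tangle diagrams differ by one local move. -/
def Step (m n : ℕ) (w w' : Word) : Prop :=
  IsTangle m w n ∧ IsTangle m w' n ∧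
    ∃ u v r r', Move r r' ∧ w = u ++ r ++ v ∧ w' = u ++ r' ++ v

/-- Equivalence of tangle diagrams with `m` end points at the bottom and `n` at the top under
isotopy and `5`-moves. -/
def TangleEquiv (m n : ℕ) : Word → Word → Prop := Relation.EqvGen (Step m n)

namespace TangleEquiv

variable {m n k k' : ℕ} {w w' w'' r r' u v : Word}

theorem refl (w : Word) : TangleEquiv m n w w := Relation.EqvGen.refl w

theorem symm (h : TangleEquiv m n w w') : TangleEquiv m n w' w := Relation.EqvGen.symm _ _ h

theorem trans (h : TangleEquiv m n w w') (h' : TangleEquiv m n w' w'') : TangleEquiv m n w w'' :=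
  Relation.EqvGen.trans _ _ _ h h'

instance : Trans (TangleEquiv m n) (TangleEquiv m n) (TangleEquiv m n) := ⟨trans⟩

theorem isTangle_iff (h : TangleEquiv m n w w') : IsTangle m w n ↔ IsTangle m w' n := by
  induction h with
  | rel _ _ h => exact iff_of_true h.1 h.2.1
  | refl _ => rfl
  | symm _ _ _ ih => exact ih.symm
  | trans _ _ _ _ _ ih ih' => exact ih.trans ih'

/-- The local move takes place at the letters from number `i` on. -/
theorem move (i : ℕ) (h : Move r r')
    (hw : w.take i ++ r ++ w.drop (i + r.length) = w := by rfl)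
    (hw' : w.take i ++ r' ++ w.drop (i + r.length) = w' := by rfl)
    (ht : IsTangle m w n := by simp) (ht' : IsTangle m w' n := by simp) :
    TangleEquiv m n w w' :=
  .rel _ _ ⟨ht, ht', _, _, _, _, h, hw.symm, hw'.symm⟩

theorem unmove (i : ℕ) (h : Move r r')
    (hw : w.take i ++ r' ++ w.drop (i + r'.length) = w := by rfl)
    (hw' : w.take i ++ r ++ w.drop (i + r'.length) = w' := by rfl)
    (ht : IsTangle m w n := by simp) (ht' : IsTangle m w' n := by simp) :
    TangleEquiv m n w w' :=
  symm (.rel _ _ ⟨ht', ht, _, _, _, _, h, hw'.symm, hw.symm⟩)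

theorem congr (hu : IsTangle k u m) (h : TangleEquiv m n w w') (hv : IsTangle n v k') :
    TangleEquiv k k' (u ++ w ++ v) (u ++ w' ++ v) := by
  induction h with
  | rel x y h =>
    obtain ⟨hx, hy, u', v', r, r', hr, rfl, rfl⟩ := h
    exact .rel _ _ ⟨(hu.append hx).append hv, (hu.append hy).append hv, u ++ u', v' ++ v, r, r', hr,
      by simp, by simp⟩
  | refl _ => exact .refl _
  | symm _ _ _ ih => exact ih.symm
  | trans _ _ _ _ _ ih ih' => exact ih.trans ih'

theorem append_right (h : TangleEquiv m n w w') (hv : IsTangle n v k) :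
    TangleEquiv m k (w ++ v) (w' ++ v) :=
  congr (u := []) rfl h hv

theorem append_left (hu : IsTangle k u m) (h : TangleEquiv m n w w') :
    TangleEquiv k n (u ++ w) (u ++ w') := by
  simpa only [List.append_nil] using congr (v := []) hu h rfl

theorem add_right (h : TangleEquiv m n w w') (k : ℕ) : TangleEquiv (m + k) (n + k) w w' := by
  induction h with
  | rel _ _ h => exact .rel _ _ ⟨h.1.add_right k, h.2.1.add_right k, h.2.2⟩
  | refl _ => exact .refl _
  | symm _ _ _ ih => exact ih.symm
  | trans _ _ _ _ _ ih ih' => exact ih.trans ih'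

theorem exchange (p q : Piece) (l k : ℕ) :
    TangleEquiv (l + p.dom + k + q.dom) (l + p.cod + k + q.cod)
      [⟨l, p⟩, ⟨l + p.cod + k, q⟩] [⟨l + p.dom + k, q⟩, ⟨l, p⟩] := by
  refine .rel _ _ ⟨?_, ?_, [], [], _, _, .regular (.exchange p q l k), rfl, rfl⟩ <;>
    simp only [IsTangle] <;> omega

theorem comm_layer {T : Word} (hT : IsTangle m T n) (q : Piece) (k : ℕ) :
    TangleEquiv (m + k + q.dom) (n + k + q.cod) (T ++ [⟨n + k, q⟩]) (⟨m + k, q⟩ :: T) := by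
  induction T generalizing m with
  | nil =>
    obtain rfl : m = n := hT
    exact refl _
  | cons t T ih =>
    obtain ⟨l, p⟩ := t
    obtain ⟨hl, hT⟩ := hT
    obtain ⟨d, rfl⟩ := Nat.exists_eq_add_of_le hl
    rw [show l + p.dom + d - p.dom + p.cod = l + p.cod + d by omega] at hT
    have hp : IsTangle (l + p.dom + d + k + q.dom) [⟨l, p⟩] (l + p.cod + d + k + q.dom) := by
      simp only [IsTangle]
      omega
    have hT' : IsTangle (l + p.cod + d + k + q.cod) T (n + k + q.cod) := by
      simpa only [← add_assoc] using hT.add_right (k + q.cod)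
    have hpq := exchange p q l (d + k)
    simp only [← add_assoc] at hpq
    exact (append_left hp (ih hT)).trans (append_right hpq hT')

end TangleEquiv

theorem toLink_eq_of_regularMove {r r' : Word} (h : RegularMove r r') {L L' : LinkDiagram}
    (hL : Replace r r' L L') : L.toLink = L'.toLink :=
  Quot.sound (.inl ⟨r, r', h, hL⟩)

theorem toLink_eq_of_curlMove {e : ℤ} {r r' : Word} (h : CurlMove e r r') {L L' : LinkDiagram}
    (hL : Replace r r' L L') : L.toLink = L'.toLink :=
  Quot.sound (.inr ⟨e, r, r', h, hL⟩)

theorem TangleEquiv.fiveMoveEquiv {w w' : Word} (h : TangleEquiv 0 0 w w') (hw : IsTangle 0 w 0)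
    (hw' : IsTangle 0 w' 0) :
    FiveMoveEquiv (LinkDiagram.toLink ⟨w, hw⟩) (LinkDiagram.toLink ⟨w', hw'⟩) := by
  induction h with
  | rel x y h =>
    obtain ⟨-, -, u, v, r, r', h, hx, hy⟩ := h
    have hL : Replace r r' ⟨x, hw⟩ ⟨y, hw'⟩ := ⟨u, v, hx, hy⟩
    cases h with
    | regular h => exact toLink_eq_of_regularMove h hL ▸ .refl _
    | curl h => exact toLink_eq_of_curlMove h hL ▸ .refl _
    | five s l => exact .rel _ _ ⟨_, _, s, l, rfl, rfl, hL⟩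
  | refl _ => exact .refl _
  | symm _ _ _ ih => exact .symm _ _ (ih hw' hw)
  | trans _ _ _ h _ ih ih' =>
    have hy := (isTangle_iff h).1 hw
    exact .trans _ _ _ (ih hw hy) (ih' hy hw')

/-- The setoid of tangle diagrams under isotopy and `5`-moves. -/
def tangleSetoid (m n : ℕ) : Setoid {w // IsTangle m w n} where
  r w w' := TangleEquiv m n w w'
  iseqv := ⟨fun _ => .refl _, .symm, .trans⟩

/-- Tangle diagrams with `m` end points at the bottom and `n` at the top, up to isotopy and
`5`-moves. -/
def TangleClass (m n : ℕ) : Type := Quotient (tangleSetoid m n)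

namespace TangleClass

variable {m n k j : ℕ} {u v w w' : Word}

/-- The class of a tangle diagram. -/
def mk (w : Word) (hw : IsTangle m w n) : TangleClass m n := Quotient.mk _ ⟨w, hw⟩

theorem mk_eq_mk {hw : IsTangle m w n} {hw' : IsTangle m w' n} :
    mk w hw = mk w' hw' ↔ TangleEquiv m n w w' := Quotient.eq

/-- The tangle `v` is put on top. -/
def stack (v : Word) (hv : IsTangle n v k) : TangleClass m n → TangleClass m k :=
  Quotient.map (fun w => ⟨w.1 ++ v, w.2.append hv⟩) fun _ _ h => h.append_right hv

theorem stack_stack (hu : IsTangle n u k) (hv : IsTangle k v j) (p : TangleClass m n) :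
    stack v hv (stack u hu p) = stack (u ++ v) (hu.append hv) p := by
  induction p using Quotient.ind
  exact mk_eq_mk.2 (List.append_assoc _ _ _ ▸ .refl _)

theorem stack_congr {hu : IsTangle n u k} {hv : IsTangle n v k} (h : TangleEquiv n k u v)
    (p : TangleClass m n) : stack u hu p = stack v hv p := by
  induction p using Quotient.ind with
  | _ w => exact mk_eq_mk.2 (h.append_left w.2)

theorem stack_nil {h : IsTangle m [] m} (p : TangleClass k m) : stack [] h p = p := by
  induction p using Quotient.ind
  exact mk_eq_mk.2 (List.append_nil _ ▸ .refl _)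

end TangleClass

/-! ### Rational tangles as plats -/

open TangleEquiv

theorem IsRationalTangle.isTangle {T : Word} (h : IsRationalTangle T) : IsTangle 2 T 2 := by
  induction h with
  | zero => simp
  | infty => rfl
  | right s _ ih => exact (IsTangle.append (k := 4) (by simp) (ih.add_right 2)).append (by simp)
  | bottom s _ ih => exact IsTangle.append (by simp) ih

/-- The plat that arises from a `2`-tangle by bending its lower end points up to the right. -/
def bend (T : Word) : Word := [cup 0, cup 1] ++ T

theorem isTangle_bend {T : Word} (hT : IsTangle 2 T 2) : IsTangle 0 (bend T) 4 :=
  IsTangle.append (by simp) (hT.add_right 2)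

theorem nested_cups_cross (s : Bool) (l : ℕ) :
    TangleEquiv l (l + 4) [cup l, cup (l + 1), cross s l]
      [cup l, cup (l + 1), cross s (l + 2)] := by
  calc TangleEquiv l (l + 4) _ [cup l, cup l, cross (!s) (l + 1)] :=
        move 1 (.regular (.slide_cup s l))
    TangleEquiv l (l + 4) _ [cup l, cup (l + 2), cross (!s) (l + 1)] :=
        unmove 0 (.regular (.exchange .cup .cup l 0))
    TangleEquiv l (l + 4) _ [cup l, cup (l + 1), cross (!!s) (l + 2)] :=
        move 1 (.regular (.slide_cup (!s) (l + 1)))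
    _ = [cup l, cup (l + 1), cross s (l + 2)] := by rw [Bool.not_not]

theorem bend_bottom (s : Bool) {T : Word} (hT : IsTangle 2 T 2) :
    TangleEquiv 0 4 (bend ([cross s 0] ++ T)) (bend T ++ [cross s 2]) :=
  (append_right (nested_cups_cross s 0) (hT.add_right 2)).trans
    (append_left (u := [cup 0, cup 1]) (by simp) (comm_layer hT (.cross s) 0).symm)

theorem cup_cross_cap (s : Bool) (l : ℕ) :
    TangleEquiv (l + 3) (l + 3) [cup (l + 2), cross s (l + 1), cap l] [cross (!s) l] := by
  calc TangleEquiv (l + 3) (l + 3) _ [cup (l + 1), cross (!s) (l + 2), cap l] :=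
        move 0 (.regular (.slide_cup s (l + 1)))
    TangleEquiv (l + 3) (l + 3) _ [cup (l + 1), cap l, cross (!s) l] :=
        unmove 1 (.regular (.exchange .cap (.cross (!s)) l 0))
    TangleEquiv (l + 3) (l + 3) _ [cross (!s) l] := move 0 (.regular (.zigzag_left l))

theorem bend_right (s : Bool) {T : Word} (hT : IsTangle 2 T 2) :
    TangleEquiv 0 4 (bend ([cup 1] ++ T ++ [cross s 2, cap 1])) (bend T ++ [cross (!s) 1]) := by
  have hcap : IsTangle 6 [cross s 2, cap 1] 4 := by simp
  have hcups : TangleEquiv 0 6 [cup 0, cup 1, cup 1] [cup 0, cup 1, cup 3] :=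
    unmove 1 (.regular (.exchange .cup .cup 1 0))
  have hcup : TangleEquiv 4 6 (cup 3 :: T) (T ++ [cup 3]) :=
    ((comm_layer hT .cup 1).add_right 1).symm
  calc TangleEquiv 0 4 _ ([cup 0, cup 1, cup 3] ++ (T ++ [cross s 2, cap 1])) := by
        simpa [bend] using append_right hcups ((hT.add_right 4).append hcap)
    TangleEquiv 0 4 _ (bend T ++ [cup 3, cross s 2, cap 1]) := by
        simpa [bend] using congr (u := [cup 0, cup 1]) (k := 0) (by simp) hcup hcap
    TangleEquiv 0 4 _ (bend T ++ [cross (!s) 1]) :=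
        append_left (isTangle_bend hT) (cup_cross_cap s 1)

theorem bend_numerator {T : Word} (hT : IsTangle 2 T 2) :
    TangleEquiv 0 0 (numerator T) (bend T ++ [cap 0, cap 0]) := by
  have hcap : IsTangle 2 [cap 0] 0 := by simp
  have hcups : TangleEquiv 0 2 [cup 0] [cup 0, cup 1, cap 2] :=
    unmove 1 (.regular (.zigzag_right 1))
  calc TangleEquiv 0 0 _ ([cup 0, cup 1, cap 2] ++ (T ++ [cap 0])) := by
        simpa [numerator] using append_right hcups (hT.append hcap)
    TangleEquiv 0 0 _ (bend T ++ [cap 2, cap 0]) := by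
        simpa [bend] using
          congr (u := [cup 0, cup 1]) (k := 0) (by simp) (comm_layer hT .cap 0).symm hcap
    TangleEquiv 0 0 _ (bend T ++ [cap 0, cap 0]) :=
        append_left (isTangle_bend hT) (unmove 0 (.regular (.exchange .cap .cap 0 0)))

theorem hopf_plat : TangleEquiv 0 0
    [cup 0, cup 1, cross true 0, cross true 0, cap 1, cap 0]
    [cup 0, cup 2, cross false 1, cross false 1, cap 0, cap 0] := by
  calc TangleEquiv 0 0 _ [cup 0, cup 0, cross false 1, cross true 0, cap 1, cap 0] :=
        move 1 (.regular (.slide_cup true 0))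
    TangleEquiv 0 0 _ [cup 0, cup 0, cross false 1, cross false 1, cap 0, cap 0] :=
        move 3 (.regular (.slide_cap true 0))
    TangleEquiv 0 0 _ [cup 0, cup 2, cross false 1, cross false 1, cap 0, cap 0] :=
        unmove 0 (.regular (.exchange .cup .cup 0 0))

theorem clasp_eq_nested_cups : TangleEquiv 2 6 [cup 1, cup 1, cross true 2, cross true 2]
    [cup 1, cup 2, cross false 3, cross true 2] := by
  calc TangleEquiv 2 6 _ [cup 1, cup 3, cross true 2, cross true 2] :=
        unmove 0 (.regular (.exchange .cup .cup 1 0))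
    TangleEquiv 2 6 _ [cup 1, cup 2, cross false 3, cross true 2] :=
        move 1 (.regular (.slide_cup true 2))

theorem nested_cups_cross_right : TangleEquiv 2 6
    [cup 1, cup 2, cross false 3, cross true 2, cross true 3]
    [cup 1, cup 2, cross true 3, cross false 2] := by
  calc TangleEquiv 2 6 _ [cup 1, cup 2, cross false 3, cross true 2, cross true 3, cross true 2,
        cross false 2] := unmove 5 (.regular (.reidemeister_two true 2))
    TangleEquiv 2 6 _ [cup 1, cup 2, cross false 3, cross true 3, cross true 2, cross true 3,
        cross false 2] := move 3 (.regular (.reidemeister_three true 2))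
    TangleEquiv 2 6 _ [cup 1, cup 2, cross true 2, cross true 3, cross false 2] :=
        move 2 (.regular (.reidemeister_two false 3))
    TangleEquiv 2 6 _ [cup 1, cup 2, cross true 3, cross false 2] := move 1 (.curl (.cup_true 2))

theorem nested_cups_cross_left : TangleEquiv 2 6
    [cup 1, cup 2, cross false 1, cross true 2, cross true 1]
    [cup 1, cup 2, cross true 1, cross false 2] := by
  calc TangleEquiv 2 6 _ [cup 1, cup 2, cross false 1, cross true 2, cross true 1, cross true 2,
        cross false 2] := unmove 5 (.regular (.reidemeister_two true 2))
    TangleEquiv 2 6 _ [cup 1, cup 2, cross false 1, cross true 1, cross true 2, cross true 1,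
        cross false 2] := unmove 3 (.regular (.reidemeister_three true 1))
    TangleEquiv 2 6 _ [cup 1, cup 2, cross true 2, cross true 1, cross false 2] :=
        move 2 (.regular (.reidemeister_two false 1))
    TangleEquiv 2 6 _ [cup 1, cup 2, cross true 1, cross false 2] := move 1 (.curl (.cup_true 2))

theorem flype_true : TangleEquiv 2 6 [cup 1, cup 1, cross true 2, cross true 2, cross true 3]
    [cup 1, cup 1, cross true 2, cross true 2, cross true 1] := by
  have hslide (s : Bool) : TangleEquiv 2 6 [cup 1, cup 2, cross s 1] [cup 1, cup 2, cross s 3] :=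
    (nested_cups_cross s 1).add_right 1
  calc TangleEquiv 2 6 _ [cup 1, cup 2, cross false 3, cross true 2, cross true 3] :=
        append_right clasp_eq_nested_cups (by simp)
    TangleEquiv 2 6 _ [cup 1, cup 2, cross true 3, cross false 2] := nested_cups_cross_right
    TangleEquiv 2 6 _ [cup 1, cup 2, cross true 1, cross false 2] :=
        append_right (hslide true).symm (by simp)
    TangleEquiv 2 6 _ [cup 1, cup 2, cross false 1, cross true 2, cross true 1] :=
        nested_cups_cross_left.symm
    TangleEquiv 2 6 _ [cup 1, cup 2, cross false 3, cross true 2, cross true 1] :=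
        append_right (v := [cross true 2, cross true 1]) (hslide false) (by simp)
    TangleEquiv 2 6 _ [cup 1, cup 1, cross true 2, cross true 2, cross true 1] :=
        append_right clasp_eq_nested_cups.symm (by simp)

theorem flype_false : TangleEquiv 2 6 [cup 1, cup 1, cross true 2, cross true 2, cross false 3]
    [cup 1, cup 1, cross true 2, cross true 2, cross false 1] := by
  have hv : IsTangle 6 [cross false 1, cross false 3] 6 := by simp
  calc TangleEquiv 2 6 _ [cup 1, cup 1, cross true 2, cross true 2, cross true 1, cross false 1,
        cross false 3] := unmove 4 (.regular (.reidemeister_two true 1))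
    TangleEquiv 2 6 _ [cup 1, cup 1, cross true 2, cross true 2, cross true 3, cross false 1,
        cross false 3] := append_right flype_true.symm hv
    TangleEquiv 2 6 _ [cup 1, cup 1, cross true 2, cross true 2, cross true 3, cross false 3,
        cross false 1] := move 5 (.regular (.exchange (.cross false) (.cross false) 1 0))
    TangleEquiv 2 6 _ [cup 1, cup 1, cross true 2, cross true 2, cross false 1] :=
        move 4 (.regular (.reidemeister_two true 3))

theorem figureEight_clasp : TangleEquiv 0 0
    [cup 0, cup 1, cup 2, cross true 0, cross false 1, cross true 0, cross false 1,
      cap 2, cap 1, cap 0]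
    [cup 0, cup 1, cup 1, cross true 2, cross true 2, cross true 4, cross false 1,
      cap 3, cap 0, cap 0] := by
  calc TangleEquiv 0 0 _ [cup 0, cup 1, cup 2, cross true 0, cross false 1, cross true 0,
        cross true 2, cap 1, cap 1, cap 0] := move 6 (.regular (.slide_cap false 1))
    TangleEquiv 0 0 _ [cup 0, cup 1, cross true 0, cup 2, cross false 1, cross true 0,
        cross true 2, cap 1, cap 1, cap 0] :=
        unmove 2 (.regular (.exchange (.cross true) .cup 0 0))
    TangleEquiv 0 0 _ [cup 0, cup 1, cross true 2, cup 2, cross false 1, cross true 0,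
        cross true 2, cap 1, cap 1, cap 0] :=
        append_right (nested_cups_cross true 0) (by simp)
    TangleEquiv 0 0 _ [cup 0, cup 1, cup 2, cross true 4, cross false 1, cross true 0,
        cross true 2, cap 1, cap 1, cap 0] :=
        unmove 2 (.regular (.exchange .cup (.cross true) 2 0))
    TangleEquiv 0 0 _ [cup 0, cup 1, cup 2, cross false 1, cross true 4, cross true 0,
        cross true 2, cap 1, cap 1, cap 0] :=
        unmove 3 (.regular (.exchange (.cross false) (.cross true) 1 1))
    TangleEquiv 0 0 _ [cup 0, cup 1, cup 2, cross false 1, cross true 4, cross true 2,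
        cross true 0, cap 1, cap 1, cap 0] :=
        move 5 (.regular (.exchange (.cross true) (.cross true) 0 0))
    TangleEquiv 0 0 _ [cup 0, cup 1, cup 2, cross false 1, cross true 2, cross true 4,
        cross true 0, cap 1, cap 1, cap 0] :=
        unmove 4 (.regular (.exchange (.cross true) (.cross true) 2 0))
    TangleEquiv 0 0 _ [cup 0, cup 1, cup 1, cross true 2, cross true 2, cross true 4,
        cross true 0, cap 1, cap 1, cap 0] := move 2 (.regular (.slide_cup false 1))
    TangleEquiv 0 0 _ [cup 0, cup 1, cup 1, cross true 2, cross true 2, cross true 4,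
        cross false 1, cap 0, cap 1, cap 0] := move 6 (.regular (.slide_cap true 0))
    TangleEquiv 0 0 _ [cup 0, cup 1, cup 1, cross true 2, cross true 2, cross true 4,
        cross false 1, cap 3, cap 0, cap 0] := move 7 (.regular (.exchange .cap .cap 0 1))

theorem figureEight_plat : TangleEquiv 0 0
    [cup 0, cup 1, cup 2, cross true 0, cross false 1, cross true 0, cross false 1,
      cap 2, cap 1, cap 0]
    [cup 0, cup 1, cross true 2, cross true 2, cross false 1, cross false 1, cap 0, cap 0] := by
  calc TangleEquiv 0 0 _ [cup 0, cup 1, cup 1, cross true 2, cross true 2, cross true 4,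
        cross false 1, cap 3, cap 0, cap 0] := figureEight_clasp
    TangleEquiv 0 0 _ [cup 0, cup 1, cup 1, cross true 2, cross true 2, cross true 4,
        cap 3, cross false 1, cap 0, cap 0] :=
        move 6 (.regular (.exchange (.cross false) .cap 1 0))
    TangleEquiv 0 0 _ [cup 0, cup 1, cup 1, cross true 2, cross true 2, cross false 3,
        cap 4, cross false 1, cap 0, cap 0] := unmove 5 (.regular (.slide_cap false 3))
    TangleEquiv 0 0 _ [cup 0, cup 1, cup 1, cross true 2, cross true 2, cross false 1,
        cap 4, cross false 1, cap 0, cap 0] :=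
        congr (u := [cup 0]) (v := [cap 4, cross false 1, cap 0, cap 0])
          (by simp) flype_false
          (by simp)
    TangleEquiv 0 0 _ [cup 0, cup 1, cup 1, cross true 2, cross true 2, cap 4,
        cross false 1, cross false 1, cap 0, cap 0] :=
        move 5 (.regular (.exchange (.cross false) .cap 1 1))
    TangleEquiv 0 0 _ [cup 0, cup 1, cup 1, cross true 2, cap 4, cross true 2,
        cross false 1, cross false 1, cap 0, cap 0] :=
        move 4 (.regular (.exchange (.cross true) .cap 2 0))
    TangleEquiv 0 0 _ [cup 0, cup 1, cup 1, cap 4, cross true 2, cross true 2,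
        cross false 1, cross false 1, cap 0, cap 0] :=
        move 3 (.regular (.exchange (.cross true) .cap 2 0))
    TangleEquiv 0 0 _ [cup 0, cup 1, cup 3, cap 4, cross true 2, cross true 2,
        cross false 1, cross false 1, cap 0, cap 0] :=
        unmove 1 (.regular (.exchange .cup .cup 1 0))
    TangleEquiv 0 0 _ [cup 0, cup 1, cross true 2, cross true 2,
        cross false 1, cross false 1, cap 0, cap 0] := move 2 (.regular (.zigzag_right 3))

/-! ### The icosahedral orbit -/

/-- An action of the braid group on three strands in which the generators `a` and `b` have order
five, with two points `A` and `C` that behave like the vertices of an icosahedron fixed by the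
rotations `a` and `b`. -/
structure IsTwistAction {Q : Type*} (a b : Q → Q) (A C : Q) : Prop where
  braid : ∀ p, a (b (a p)) = b (a (b p))
  fst_five : ∀ p, a (a (a (a (a p)))) = p
  snd_five : ∀ p, b (b (b (b (b p)))) = p
  fst_fixed : a A = A
  snd_fixed : b C = C
  fst_snd : a (b A) = C
  snd_fst : b (a C) = A

namespace IsTwistAction

variable {Q : Type*} {a b : Q → Q} {A C : Q}

theorem snd_injective (h : IsTwistAction a b A C) : Function.Injective b := fun p q hpq => by
  rw [← h.snd_five p, hpq, h.snd_five]

theorem fst_injective (h : IsTwistAction a b A C) : Function.Injective a := fun p q hpq => by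
  rw [← h.fst_five p, hpq, h.fst_five]

theorem fst_snd_sq (h : IsTwistAction a b A C) : a (b (b A)) = b (b (b A)) := by
  refine h.snd_injective (h.snd_injective ?_)
  calc b (b (a (b (b A)))) = b (a (b (a (b A)))) := by rw [h.braid]
    _ = A := by rw [h.fst_snd, h.snd_fixed, h.snd_fst]
    _ = b (b (b (b (b A)))) := (h.snd_five A).symm

theorem fst_snd_cube (h : IsTwistAction a b A C) :
    a (b (b (b A))) = b (b (b (b (a (a C))))) := by
  refine h.snd_injective ?_
  calc b (a (b (b (b A)))) = a (b (a (b (b A)))) := (h.braid _).symm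
    _ = a (b (b (b (b A)))) := by rw [h.fst_snd_sq]
    _ = a (a C) := by rw [← h.snd_fst, h.snd_five]
    _ = b (b (b (b (b (a (a C)))))) := (h.snd_five _).symm

theorem fst_cube (h : IsTwistAction a b A C) : a (a (a C)) = b (a (a C)) := by
  symm
  calc b (a (a C)) = b (a (b (b (b (b A))))) := by rw [← h.snd_fst, h.snd_five]
    _ = a (b (a (b (b (b A))))) := (h.braid _).symm
    _ = a (a (a C)) := by rw [h.fst_snd_cube, h.snd_five]

theorem fst_pow_four (h : IsTwistAction a b A C) : a (a (a (a C))) = b A := by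
  rw [← h.fst_snd, h.fst_five]

theorem fst_snd_snd_fst (h : IsTwistAction a b A C) : a (b (b (a (a C)))) = b (b A) := by
  calc a (b (b (a (a C)))) = b (a (a (a (a C)))) := by rw [← h.fst_cube, h.braid, ← h.fst_cube]
    _ = b (b A) := by rw [h.fst_pow_four]

theorem fst_fixed_snd_cube (h : IsTwistAction a b A C) :
    a (b (b (b (a (a C))))) = b (b (b (a (a C)))) := by
  refine h.snd_injective ?_
  calc b (a (b (b (b (a (a C)))))) = a (b (a (b (b (a (a C)))))) := (h.braid _).symm
    _ = b (b (b (b (a (a C))))) := by rw [h.fst_snd_snd_fst, h.fst_snd_cube]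

theorem fst_antipode (h : IsTwistAction a b A C) :
    a (a (a (a (b (b A))))) = b (b (a (a C))) := by
  rw [← h.fst_snd_snd_fst, h.fst_five]

theorem snd_antipode (h : IsTwistAction a b A C) :
    b (a (a (a (b (b A))))) = a (a (a (b (b A)))) := by
  refine h.fst_injective ?_
  calc a (b (a (a (a (b (b A)))))) = b (a (b (a (a (b (b A)))))) := h.braid _
    _ = b (b (a (a C))) := by rw [h.fst_snd_sq, h.fst_snd_cube, h.snd_five, h.fst_cube]
    _ = a (a (a (a (b (b A))))) := h.fst_antipode.symm

/-- Representatives of the four orbits of `b` on the twelve vertices: these orbits consist of the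
neighbours of `C`, of `C`, of the neighbours of the antipode of `C`, and of this antipode. -/
def orbitRep (a b : Q → Q) (A C : Q) : Fin 4 → Q := ![A, C, a (a C), a (a (a (b (b A))))]

/-- The vertices of the icosahedron, namely the elements of the four orbits of `b`. -/
def IsVertex (a b : Q → Q) (A C p : Q) : Prop := ∃ i k, p = b^[k] (orbitRep a b A C i)

theorem isVertex_orbitRep (i : Fin 4) : IsVertex a b A C (orbitRep a b A C i) := ⟨i, 0, rfl⟩

theorem IsVertex.snd {p : Q} (hp : IsVertex a b A C p) : IsVertex a b A C (b p) := by
  obtain ⟨i, k, rfl⟩ := hp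
  exact ⟨i, k + 1, (Function.iterate_succ_apply' b k _).symm⟩

theorem exists_iterate_lt_five (h : IsTwistAction a b A C) (k : ℕ) (p : Q) :
    ∃ j < 5, b^[k] p = b^[j] p :=
  ⟨k % 5, Nat.mod_lt k (by decide),
    (Function.IsPeriodicPt.iterate_mod_apply (n := 5) (h.snd_five p) k).symm⟩

theorem isVertex_fst (h : IsTwistAction a b A C) {p : Q} (hp : IsVertex a b A C p) :
    IsVertex a b A C (a p) := by
  obtain ⟨i, k, rfl⟩ := hp
  obtain ⟨j, hj, hk⟩ := h.exists_iterate_lt_five k (orbitRep a b A C i)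
  rw [hk]
  fin_cases i
  · change IsVertex a b A C (a (b^[j] A))
    interval_cases j
    · exact ⟨0, 0, h.fst_fixed⟩
    · exact ⟨1, 0, h.fst_snd⟩
    · exact ⟨0, 3, h.fst_snd_sq⟩
    · exact ⟨2, 4, h.fst_snd_cube⟩
    · exact ⟨2, 0, congrArg a (by rw [← h.snd_fst]; exact h.snd_five _)⟩
  · refine ⟨0, 4, ?_⟩
    change a (b^[j] C) = b (b (b (b A)))
    rw [Function.iterate_fixed h.snd_fixed, ← h.snd_fst, h.snd_five]
  · change IsVertex a b A C (a (b^[j] (a (a C))))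
    interval_cases j
    · exact ⟨2, 1, h.fst_cube⟩
    · exact ⟨0, 1, by rw [Function.iterate_one, ← h.fst_cube, h.fst_pow_four]; rfl⟩
    · exact ⟨0, 2, h.fst_snd_snd_fst⟩
    · exact ⟨2, 3, h.fst_fixed_snd_cube⟩
    · exact ⟨3, 0, congrArg a (by rw [h.fst_snd_sq, h.fst_snd_cube]; rfl)⟩
  · refine ⟨2, 2, ?_⟩
    change a (b^[j] (a (a (a (b (b A)))))) = b (b (a (a C)))
    rw [Function.iterate_fixed h.snd_antipode, h.fst_antipode]

theorem exists_eq_of_snd_invariant {R : Type*} {N : Q → R} (hN : ∀ p, N (b p) = N p) {p : Q}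
    (hp : IsVertex a b A C p) : ∃ i, N p = N (orbitRep a b A C i) := by
  obtain ⟨i, k, rfl⟩ := hp
  refine ⟨i, ?_⟩
  induction k with
  | zero => rfl
  | succ k ih => rw [Function.iterate_succ_apply', hN, ih]

theorem value_orbitRep {R : Type*} [CommRing R] {x : R} (h : IsTwistAction a b A C)
    (hx : x ^ 2 + x = 1) {N c : Q → R} (hN : ∀ p, N (b p) = N p) (hc : ∀ p, c (a p) = c p)
    (skein : ∀ p, N (a (a p)) + N p = x * (N (a p) + c p)) (hA : N A = 1) (hC : c C = 1) :
    ∀ i, N (orbitRep a b A C i) = ![1, 2 * x + 1, -1, -(2 * x + 1)] i := by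
  have value_fst_C : N (a C) = 1 := by rw [← hN, h.snd_fst, hA]
  have cap_snd_A : c (b A) = 1 := by rw [← h.fst_pow_four, hc, hc, hc, hc, hC]
  have value_C : N C = 2 * x + 1 := by
    have hskein : 1 + 1 = x * (N C + 1) := by
      simpa only [h.fst_five, h.fst_pow_four, h.fst_snd, cap_snd_A, hN, hA, value_fst_C] using
        skein (a (a (a (a C))))
    linear_combination -(x + 1) * hskein - (N C + 1) * hx
  have value_fst_sq_C : N (a (a C)) = -1 := by
    have hskein : N (a (a C)) + (2 * x + 1) = x * (1 + 1) := by
      simpa only [value_fst_C, value_C, hC] using skein C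
    linear_combination hskein
  have cap_snd_sq_A : c (b (b A)) = -1 := by
    have hskein : 1 + -1 = x * (1 + c (b (b (a (a C))))) := by
      simpa only [h.fst_snd_snd_fst, h.fst_snd_sq, hN, hA, value_fst_sq_C] using
        skein (b (b (a (a C))))
    rw [← h.fst_snd_snd_fst, hc]
    linear_combination -(x + 1) * hskein - (c (b (b (a (a C)))) + 1) * hx
  have value_antipode : N (a (a (a (b (b A))))) = -(2 * x + 1) := by
    have h₁ : N (a (b (b A))) = 1 := by rw [h.fst_snd_sq, hN, hN, hN, hA]
    have h₂ : N (a (a (b (b A)))) = -1 := by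
      rw [h.fst_snd_sq, h.fst_snd_cube, hN, hN, hN, hN, value_fst_sq_C]
    have hskein : N (a (a (a (b (b A))))) + 1 = x * (-1 + -1) := by
      simpa only [h₁, h₂, hc, cap_snd_sq_A] using skein (a (b (b A)))
    linear_combination hskein
  intro i
  fin_cases i
  exacts [hA, value_C, value_fst_sq_C, value_antipode]

end IsTwistAction

/-! ### The twists of plats -/

/-- The representatives of the four classes of rational links under `5`-moves. -/
def basicLink : Fin 4 → Link := ![trivialKnot, trivialLinkTwo, hopfLink, figureEightKnot]

namespace TangleClass

/-- The closure of a tangle by a tangle on top, as a link up to `5`-moves. -/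
def closure {m : ℕ} (v : Word) (hv : IsTangle m v 0) : TangleClass 0 m → Quot FiveMove :=
  Quotient.lift (fun w => Quot.mk _ (LinkDiagram.toLink ⟨w.1 ++ v, w.2.append hv⟩)) fun _ _ h =>
    Quot.eq.2 ((h.append_right hv).fiveMoveEquiv _ _)

theorem closure_stack {m n : ℕ} {u v v' : Word} {hu : IsTangle m u n} {hv : IsTangle n v 0}
    {hv' : IsTangle m v' 0} (h : TangleEquiv m 0 (u ++ v) v') (p : TangleClass 0 m) :
    closure v hv (stack u hu p) = closure v' hv' p := by
  induction p using Quotient.ind with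
  | _ w =>
    have h' : TangleEquiv 0 0 (w.1 ++ u ++ v) (w.1 ++ v') := by
      simpa only [List.append_assoc] using h.append_left w.2
    exact Quot.eq.2 (h'.fiveMoveEquiv _ _)

/-- The twist of the two inner end points of a plat. -/
def inner (s : Bool) : TangleClass 0 4 → TangleClass 0 4 :=
  stack [cross s 1] (isTangle_cross s (by decide))

/-- The twist of the two right end points of a plat. -/
def outer (s : Bool) : TangleClass 0 4 → TangleClass 0 4 :=
  stack [cross s 2] (isTangle_cross s (by decide))

/-- The plat with two nested minima. -/
def nested : TangleClass 0 4 := mk [cup 0, cup 1] (by simp)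

/-- The plat with two minima beside each other. -/
def parallel : TangleClass 0 4 := mk [cup 0, cup 2] (by simp)

/-- The closure of a plat by two maxima beside each other. -/
def platClosure : TangleClass 0 4 → Quot FiveMove := closure [cap 0, cap 0] (by simp)

/-- The closure of a plat by two nested maxima. -/
def nestedClosure : TangleClass 0 4 → Quot FiveMove := closure [cap 1, cap 0] (by simp)

theorem inner_false (p : TangleClass 0 4) : inner false p = (inner true)^[4] p := by
  have h : TangleEquiv 4 4 [cross false 1]
      [cross true 1, cross true 1, cross true 1, cross true 1] :=
    calc TangleEquiv 4 4 _ [cross false 1, cross true 1, cross true 1, cross true 1, cross true 1,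
          cross true 1] := move 1 (.five true 1)
      TangleEquiv 4 4 _ _ := move 0 (.regular (.reidemeister_two false 1))
  simp only [Function.iterate_succ_apply', Function.iterate_zero_apply, inner, stack_stack]
  exact stack_congr h p

theorem outer_false (p : TangleClass 0 4) : outer false p = (outer true)^[4] p := by
  have h : TangleEquiv 4 4 [cross false 2]
      [cross true 2, cross true 2, cross true 2, cross true 2] :=
    calc TangleEquiv 4 4 _ [cross false 2, cross true 2, cross true 2, cross true 2, cross true 2,
          cross true 2] := move 1 (.five true 2)
      TangleEquiv 4 4 _ _ := move 0 (.regular (.reidemeister_two false 2))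
  simp only [Function.iterate_succ_apply', Function.iterate_zero_apply, outer, stack_stack]
  exact stack_congr h p

theorem isTwistAction : IsTwistAction (inner true) (outer true) nested parallel where
  braid p := by
    simp only [inner, outer, stack_stack]
    exact stack_congr (move 0 (.regular (.reidemeister_three true 1))) p
  fst_five p := by
    simp only [inner, stack_stack]
    exact (stack_congr (unmove 0 (.five true 1)) p).trans (stack_nil (h := rfl) p)
  snd_five p := by
    simp only [outer, stack_stack]
    exact (stack_congr (unmove 0 (.five true 2)) p).trans (stack_nil (h := rfl) p)
  fst_fixed := mk_eq_mk.2 (move 1 (.curl (.cup_true 1)))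
  snd_fixed := mk_eq_mk.2 (move 1 (.curl (.cup_true 2)))
  fst_snd := mk_eq_mk.2 <|
    calc TangleEquiv 0 4 [cup 0, cup 1, cross true 2, cross true 1]
          [cup 0, cup 2, cross false 1, cross true 1] := unmove 1 (.regular (.slide_cup false 1))
      TangleEquiv 0 4 _ [cup 0, cup 2] := move 2 (.regular (.reidemeister_two false 1))
  snd_fst := mk_eq_mk.2 <|
    calc TangleEquiv 0 4 [cup 0, cup 2, cross true 1, cross true 2]
          [cup 0, cup 1, cross false 2, cross true 2] := move 1 (.regular (.slide_cup true 1))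
      TangleEquiv 0 4 _ [cup 0, cup 1] := move 2 (.regular (.reidemeister_two false 2))

theorem platClosure_outer (p : TangleClass 0 4) : platClosure (outer true p) = platClosure p :=
  closure_stack (calc
    TangleEquiv 4 0 [cross true 2, cap 0, cap 0] [cap 0, cross true 0, cap 0] :=
      unmove 0 (.regular (.exchange .cap (.cross true) 0 0))
    TangleEquiv 4 0 _ [cap 0, cap 0] := move 1 (.curl (.cap_true 0))) p

theorem nestedClosure_inner (p : TangleClass 0 4) :
    nestedClosure (inner true p) = nestedClosure p :=
  closure_stack (move 0 (.curl (.cap_true 1))) p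

theorem platClosure_nested : platClosure nested = Quot.mk _ trivialKnot :=
  Quot.eq.2 <| TangleEquiv.fiveMoveEquiv (move 1 (.regular (.zigzag_left 0))) _ _

theorem platClosure_parallel : platClosure parallel = Quot.mk _ trivialLinkTwo :=
  Quot.eq.2 <| TangleEquiv.fiveMoveEquiv (unmove 1 (.regular (.exchange .cap .cup 0 0))) _ _

theorem nestedClosure_parallel : nestedClosure parallel = Quot.mk _ trivialKnot :=
  Quot.eq.2 <| TangleEquiv.fiveMoveEquiv (move 1 (.regular (.zigzag_left 1))) _ _

theorem inner_false_inner_false (p : TangleClass 0 4) :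
    inner false (inner false p) = inner true (inner true (inner true p)) := by
  simp only [inner_false, Function.iterate_succ_apply', Function.iterate_zero_apply,
    isTwistAction.fst_five]

theorem platClosure_hopf : platClosure (inner true (inner true parallel)) = Quot.mk _ hopfLink := by
  rw [← platClosure_outer, ← isTwistAction.fst_cube, ← inner_false_inner_false]
  exact Quot.eq.2 <| hopf_plat.symm.fiveMoveEquiv _ _

theorem platClosure_figureEight :
    platClosure (inner true (inner true (inner true (outer true (outer true nested))))) =
      Quot.mk _ figureEightKnot := by
  rw [← inner_false_inner_false]
  exact Quot.eq.2 <| figureEight_plat.symm.fiveMoveEquiv _ _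

/-- The vertices of the icosahedron of plats. -/
def IsPlatVertex : TangleClass 0 4 → Prop :=
  IsTwistAction.IsVertex (inner true) (outer true) nested parallel

theorem platClosure_orbitRep (i : Fin 4) :
    platClosure (IsTwistAction.orbitRep (inner true) (outer true) nested parallel i) =
      Quot.mk _ (basicLink i) := by
  fin_cases i
  exacts [platClosure_nested, platClosure_parallel, platClosure_hopf, platClosure_figureEight]

variable {p : TangleClass 0 4}

theorem IsPlatVertex.inner (hp : IsPlatVertex p) (s : Bool) : IsPlatVertex (inner s p) := by
  cases s with
  | true => exact isTwistAction.isVertex_fst hp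
  | false =>
    rw [inner_false]
    exact Function.Iterate.rec _ hp (fun _ => isTwistAction.isVertex_fst) 4

theorem IsPlatVertex.outer (hp : IsPlatVertex p) (s : Bool) : IsPlatVertex (outer s p) := by
  cases s with
  | true => exact IsTwistAction.IsVertex.snd hp
  | false =>
    rw [outer_false]
    exact Function.Iterate.rec _ hp (fun _ => IsTwistAction.IsVertex.snd) 4

theorem IsPlatVertex.exists_platClosure_eq (hp : IsPlatVertex p) :
    ∃ i, platClosure p = Quot.mk _ (basicLink i) := by
  obtain ⟨i, hi⟩ := IsTwistAction.exists_eq_of_snd_invariant platClosure_outer hp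
  exact ⟨i, hi.trans (platClosure_orbitRep i)⟩

end TangleClass

open TangleClass

theorem IsRationalTangle.isPlatVertex_bend {T : Word} (hT : IsRationalTangle T) :
    IsPlatVertex (mk (bend T) (isTangle_bend hT.isTangle)) := by
  induction hT with
  | zero =>
    have h : TangleEquiv 0 4 [cup 0, cup 1, cap 0, cup 0] [cup 0, cup 2] :=
      calc TangleEquiv 0 4 _ [cup 0, cup 0] := move 1 (.regular (.zigzag_left 0))
        TangleEquiv 0 4 _ [cup 0, cup 2] := unmove 0 (.regular (.exchange .cup .cup 0 0))
    exact mk_eq_mk.2 h ▸ IsTwistAction.isVertex_orbitRep 1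
  | infty => exact IsTwistAction.isVertex_orbitRep 0
  | right s hT ih => exact mk_eq_mk.2 (bend_right s hT.isTangle) ▸ ih.inner (!s)
  | bottom s hT ih => exact mk_eq_mk.2 (bend_bottom s hT.isTangle) ▸ ih.outer s

theorem IsRationalLink.exists_fiveMoveEquiv {L : Link} (hL : IsRationalLink L) :
    ∃ i, FiveMoveEquiv L (basicLink i) := by
  obtain ⟨T, ⟨w, hw⟩, hT, rfl, rfl⟩ := hL
  obtain ⟨i, hi⟩ := hT.isPlatVertex_bend.exists_platClosure_eq
  exact ⟨i, ((bend_numerator hT.isTangle).fiveMoveEquiv _ _).trans _ _ _ (Quot.eq.1 hi)⟩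

/-! ### Invariance of the Kauffman polynomial under `5`-moves -/

theorem isTangle_replicate_cross (s : Bool) {l m : ℕ} (hl : l + 2 ≤ m) (k : ℕ) :
    IsTangle m (List.replicate k (cross s l)) m := by
  induction k with
  | zero => rfl
  | succ k ih => exact (isTangle_cross s hl).append ih

theorem isTangle_cap_cup {l m : ℕ} (hl : l + 2 ≤ m) : IsTangle m [cap l, cup l] m := by
  simp
  omega

section Twisted

variable {u v : Word} {l m : ℕ}

/-- The diagram in which `k` half-twists of the strands number `l` and `l + 1` stand between the
words `u` and `v`. -/
def twisted (hl : l + 2 ≤ m) (hu : IsTangle 0 u m) (hv : IsTangle m v 0) (s : Bool) (k : ℕ) :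
    LinkDiagram :=
  ⟨u ++ List.replicate k (cross s l) ++ v,
    (hu.append (isTangle_replicate_cross s hl k)).append hv⟩

theorem toLink_twisted_cup (hl : l + 2 ≤ m) (hu : IsTangle 0 u m) (hv : IsTangle m v 0) (s : Bool)
    (k : ℕ) :
    (twisted hl (hu.append (isTangle_cap_cup hl)) hv s k).toLink =
      (twisted hl (hu.append (isTangle_cap_cup hl)) hv s 0).toLink := by
  have hcurl : ∃ e, CurlMove e [cup l, cross s l] [cup l] := by
    cases s
    exacts [⟨_, .cup_false l⟩, ⟨_, .cup_true l⟩]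
  obtain ⟨e, he⟩ := hcurl
  induction k with
  | zero => rfl
  | succ k ih =>
    refine (toLink_eq_of_curlMove he ?_).trans ih
    exact ⟨u ++ [cap l], List.replicate k (cross s l) ++ v,
      by simp [twisted, List.replicate_succ], by simp [twisted]⟩

variable {R : Type*} [CommRing R] {x : R} {F : Link → R}

theorem IsKauffman.twisted_add_twisted (hF : IsKauffman (1 : Rˣ) x fun D => F D.toLink)
    (hl : l + 2 ≤ m) (hu : IsTangle 0 u m) (hv : IsTangle m v 0) (s : Bool) (k : ℕ) :
    F (twisted hl hu hv s (k + 2)).toLink + F (twisted hl hu hv s k).toLink =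
      x * (F (twisted hl hu hv s (k + 1)).toLink +
        F (twisted hl (hu.append (isTangle_cap_cup hl)) hv s 0).toLink) := by
  have hk := (isTangle_replicate_cross s hl (k + 1)).append hv
  let D (s' : Bool) : LinkDiagram :=
    ⟨u ++ [cross s' l] ++ (List.replicate (k + 1) (cross s l) ++ v),
      (hu.append (isTangle_cross s' hl)).append hk⟩
  have hsame : D s = twisted hl hu hv s (k + 2) := by
    simp [D, twisted, List.replicate_succ]
  have hopposite : (D !s).toLink = (twisted hl hu hv s k).toLink :=
    toLink_eq_of_regularMove (.reidemeister_two (!s) l)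
      ⟨u, List.replicate k (cross s l) ++ v, by simp [D, List.replicate_succ], by simp [twisted]⟩
  have hskein : F (D true).toLink + F (D false).toLink = _ :=
    hF.skein u _ l _ _ (twisted hl hu hv s (k + 1))
      (twisted hl (hu.append (isTangle_cap_cup hl)) hv s (k + 1)) rfl rfl
      (List.append_assoc ..) (List.append_assoc ..)
  rw [toLink_twisted_cup hl hu hv s (k + 1)] at hskein
  rw [← hskein, ← hsame, ← hopposite]
  cases s
  exacts [add_comm _ _, rfl]

end Twisted

section Values

variable {R : Type*} [CommRing R] {x : R} {F : Link → R}

theorem eq_of_five_skein (hx : x ^ 2 + x = 1) {g : ℕ → R} {c : R}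
    (hg : ∀ k, g (k + 2) + g k = x * (g (k + 1) + c)) : g 5 = g 0 := by
  linear_combination hg 3 + x * hg 2 + (x ^ 2 - 1) * hg 1 + (x ^ 3 - 2 * x) * hg 0 +
    ((x ^ 2 - x - 1) * g 1 - (x - 1) * g 0 + x ^ 2 * c) * hx

namespace IsKauffman

theorem eq_of_fiveMove (hF : IsKauffman (1 : Rˣ) x fun D => F D.toLink) (hx : x ^ 2 + x = 1)
    {L L' : Link} (h : FiveMove L L') : F L = F L' := by
  obtain ⟨⟨w, hw⟩, ⟨w', hw'⟩, s, l, rfl, rfl, u, v, h₁, h₂⟩ := h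
  simp only [List.append_nil] at h₁ h₂
  subst h₁ h₂
  obtain ⟨m, hu, hm⟩ := isTangle_append.1 (List.append_assoc u _ v ▸ hw')
  have hl : l + 2 ≤ m := hm.1
  obtain ⟨m', hm', hv⟩ := isTangle_append.1 hm
  obtain rfl : m' = m := hm'.top_unique (isTangle_replicate_cross s hl 5)
  have hfive := eq_of_five_skein hx (g := fun k => F (twisted hl hu hv s k).toLink)
    (hF.twisted_add_twisted hl hu hv s)
  simpa [twisted] using hfive.symm

theorem eq_of_fiveMoveEquiv (hF : IsKauffman (1 : Rˣ) x fun D => F D.toLink) (hx : x ^ 2 + x = 1)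
    {L L' : Link} (h : FiveMoveEquiv L L') : F L = F L' := by
  induction h with
  | rel _ _ h => exact hF.eq_of_fiveMove hx h
  | refl _ => rfl
  | symm _ _ _ ih => exact ih.symm
  | trans _ _ _ _ _ ih ih' => exact ih.trans ih'

/-- The invariant `F`, regarded as a function on links up to `5`-moves. -/
def quotValue (hF : IsKauffman (1 : Rˣ) x fun D => F D.toLink) (hx : x ^ 2 + x = 1) :
    Quot FiveMove → R :=
  Quot.lift F fun _ _ => hF.eq_of_fiveMove hx

theorem quotValue_skein (hF : IsKauffman (1 : Rˣ) x fun D => F D.toLink) (hx : x ^ 2 + x = 1)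
    (p : TangleClass 0 4) :
    hF.quotValue hx (platClosure (inner true p)) + hF.quotValue hx (platClosure (inner false p)) =
      x * (hF.quotValue hx (platClosure p) + hF.quotValue hx (nestedClosure p)) := by
  have hcap : TangleEquiv 4 0 [cap 1, cup 1, cap 0, cap 0] [cap 1, cap 0] :=
    move 1 (.regular (.zigzag_left 0))
  have hnested : platClosure (stack [cap 1, cup 1] (isTangle_cap_cup (by decide)) p) =
      nestedClosure p := closure_stack hcap p
  rw [← hnested]
  induction p using Quotient.ind with
  | _ w => exact hF.skein w.1 [cap 0, cap 0] 1 _ _ _ _ rfl rfl rfl rfl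

theorem quotValue_skein_sq (hF : IsKauffman (1 : Rˣ) x fun D => F D.toLink) (hx : x ^ 2 + x = 1)
    (p : TangleClass 0 4) :
    hF.quotValue hx (platClosure (inner true (inner true p))) +
        hF.quotValue hx (platClosure p) =
      x * (hF.quotValue hx (platClosure (inner true p)) +
        hF.quotValue hx (nestedClosure p)) := by
  have h : inner false (inner true p) = p := (inner_false _).trans (isTwistAction.fst_five p)
  simpa only [h, nestedClosure_inner] using hF.quotValue_skein hx (inner true p)

theorem value_basicLink (hF : IsKauffman (1 : Rˣ) x fun D => F D.toLink) (hx : x ^ 2 + x = 1)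
    (i : Fin 4) : F (basicLink i) = ![1, 2 * x + 1, -1, -(2 * x + 1)] i := by
  let N := hF.quotValue hx
  have hvalue := isTwistAction.value_orbitRep hx (N := N ∘ platClosure) (c := N ∘ nestedClosure)
    (fun p => congrArg N (platClosure_outer p)) (fun p => congrArg N (nestedClosure_inner p))
    (hF.quotValue_skein_sq hx) ((congrArg N platClosure_nested).trans hF.circle)
    ((congrArg N nestedClosure_parallel).trans hF.circle) i
  exact (congrArg N (platClosure_orbitRep i)).symm.trans hvalue

end IsKauffman

end Values

end Tangles

theorem two_mul_cos_sq_add :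
    (2 * Real.cos (2 * Real.pi / 5)) ^ 2 + 2 * Real.cos (2 * Real.pi / 5) = 1 := by
  rw [two_mul_cos_two_pi_div_five]
  linear_combination Real.sq_sqrt (show (0 : ℝ) ≤ 5 by norm_num) / 4

namespace IsKauffmanValueAtOne

variable {F : Link → ℝ}

theorem eq_of_fiveMoveEquiv (hF : IsKauffmanValueAtOne (2 * Real.cos (2 * Real.pi / 5)) F)
    {L L' : Link} (h : FiveMoveEquiv L L') : F L = F L' :=
  IsKauffman.eq_of_fiveMoveEquiv hF two_mul_cos_sq_add h

theorem value_basicLink (hF : IsKauffmanValueAtOne (2 * Real.cos (2 * Real.pi / 5)) F)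
    (i : Fin 4) : F (basicLink i) = ![1, √5, -1, -√5] i := by
  rw [IsKauffman.value_basicLink hF two_mul_cos_sq_add i, two_mul_cos_two_pi_div_five,
    show 2 * ((√5 - 1) / 2) + 1 = √5 by ring]

theorem basicLink_injective (hF : IsKauffmanValueAtOne (2 * Real.cos (2 * Real.pi / 5)) F) :
    Function.Injective fun i => F (basicLink i) := by
  have h : 1 < √5 := Real.lt_sqrt_of_sq_lt (by norm_num)
  intro i j hij
  replace hij : ![1, √5, -1, -√5] i = ![1, √5, -1, -√5] j := by
    simpa only [hF.value_basicLink] using hij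
  fin_cases i <;> fin_cases j <;> simp at hij ⊢ <;> linarith

end IsKauffmanValueAtOne

end KnotDiagram

theorem theorem2p9 :
    (∀ L : KnotDiagram.Link, KnotDiagram.IsRationalLink L →
      ∃! i : Fin 4, KnotDiagram.FiveMoveEquiv L
        (![KnotDiagram.trivialKnot, KnotDiagram.trivialLinkTwo, KnotDiagram.hopfLink,
          KnotDiagram.figureEightKnot] i)) ∧
    (∃ F : KnotDiagram.Link → ℝ,
      KnotDiagram.IsKauffmanValueAtOne (2 * Real.cos (2 * Real.pi / 5)) F) ∧
    ∀ F : KnotDiagram.Link → ℝ,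
      KnotDiagram.IsKauffmanValueAtOne (2 * Real.cos (2 * Real.pi / 5)) F →
      (∀ L L' : KnotDiagram.Link, KnotDiagram.IsRationalLink L → KnotDiagram.IsRationalLink L' →
        (KnotDiagram.FiveMoveEquiv L L' ↔ F L = F L')) ∧
      F KnotDiagram.trivialKnot = 1 ∧ F KnotDiagram.trivialLinkTwo = √5 ∧
      F KnotDiagram.hopfLink = -1 ∧ F KnotDiagram.figureEightKnot = -√5 := by
  refine ⟨fun L hL => ?_, KnotDiagram.exists_isKauffmanValueAtOne, fun F hF =>
    ⟨fun L L' hL hL' => ⟨hF.eq_of_fiveMoveEquiv, fun h => ?_⟩,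
      hF.value_basicLink 0, hF.value_basicLink 1, hF.value_basicLink 2, hF.value_basicLink 3⟩⟩
  · obtain ⟨F, hF⟩ := KnotDiagram.exists_isKauffmanValueAtOne
    obtain ⟨i, hi⟩ := hL.exists_fiveMoveEquiv
    refine ⟨i, hi, fun j hj => hF.basicLink_injective ?_⟩
    exact (hF.eq_of_fiveMoveEquiv hj).symm.trans (hF.eq_of_fiveMoveEquiv hi)
  · obtain ⟨i, hi⟩ := hL.exists_fiveMoveEquiv
    obtain ⟨j, hj⟩ := hL'.exists_fiveMoveEquiv
    obtain rfl : i = j := hF.basicLink_injective <|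
      (hF.eq_of_fiveMoveEquiv hi).symm.trans (h.trans (hF.eq_of_fiveMoveEquiv hj))
    exact hi.trans _ _ _ (hj.symm _ _)
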